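/- Let $S$ be a semiring with $0$ and $1$ (with $0s=0=s0$; not necessarily commutative). A left $S$-semimodule is a commutative monoid $(M,+,0)$ with a unital, biadditive, associative action of $S$ satisfying $s0=0=0m$. A sequence $0\to A\xrightarrow{f}B\xrightarrow{g}C\to 0$ of semimodules is short exact if $f$ is a kernel of $g$ and $g$ is a cokernel of $f$ in the category of left $S$-semimodules. A left $S$-semimodule $M$ is *e-injective* if the contravariant functor $\mathrm{Hom}_S(-,M)$ from left $S$-semimodules to commutative monoids is exact, i.e. for every short exact sequence as above the sequence $0\to \mathrm{Hom}_S(C,M)\to\mathrm{Hom}_S(B,M)\to\mathrm{Hom}_S(A,M)\to 0$ is short exact in the category of commutative monoids. A left $S$-semimodule is *projective* if it is a retract of a free one (a direct sum of copies of ${}_SS$). Let $V(S)=\{s\in S\mid s+s'=0\text{ for some }s'\in S\}$, and let $S/V(S)$ be the factor semimodule of ${}_SS$ by the congruence $s\equiv t\iff s+v=t+v'$ for some $v,v'\in V(S)$. A *quasi-Frobenius ring* is a ring that is left and right Artinian and injective both as a left and as a right module over itself. **Theorem 5.4.** For every semiring $S$ the following conditions are equivalent: 1. $S$ is a quasi-Frobenius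 ring (in particular, $S$ is a ring); 2. every projective left $S$-semimodule is e-injective; 3. every e-injective left $S$-semimodule is projective, and the left $S$-semimodule $S/V(S)$ can be embedded in (admits an injective $S$-homomorphism to) an e-injective left $S$-semimodule. -/

import Mathlib

universe w v u

namespace ESemimod

/-- `k : K → A` is a kernel of `f : A → B` in the category of left `R`-semimodules (universal
property among morphisms killed by `f`). A semimodule over a semiring is a Mathlib `Module`. -/
def IsKernel {R : Type w} [Semiring R] {K A B : Type v}
    [AddCommMonoid K] [AddCommMonoid A] [AddCommMonoid B] [Module R K] [Module R A] [Module R B]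
    (k : K →ₗ[R] A) (f : A →ₗ[R] B) : Prop :=
  f ∘ₗ k = 0 ∧
    ∀ (X : Type v) [AddCommMonoid X] [Module R X] (x : X →ₗ[R] A), f ∘ₗ x = 0 →
      ∃! i : X →ₗ[R] K, x = k ∘ₗ i

/-- `c : B → C` is a cokernel of `f : A → B` in the category of left `R`-semimodules. -/
def IsCokernel {R : Type w} [Semiring R] {A B C : Type v}
    [AddCommMonoid A] [AddCommMonoid B] [AddCommMonoid C] [Module R A] [Module R B] [Module R C]
    (c : B →ₗ[R] C) (f : A →ₗ[R] B) : Prop :=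
  c ∘ₗ f = 0 ∧
    ∀ (X : Type v) [AddCommMonoid X] [Module R X] (x : B →ₗ[R] X), x ∘ₗ f = 0 →
      ∃! i : C →ₗ[R] X, x = i ∘ₗ c

/-- `0 → A → B → C → 0` (with maps `f`, `g`) is a short exact sequence of left `R`-semimodules:
`f` is a kernel of `g` and `g` is a cokernel of `f`. -/
def IsShortExact {R : Type w} [Semiring R] {A B C : Type v}
    [AddCommMonoid A] [AddCommMonoid B] [AddCommMonoid C] [Module R A] [Module R B] [Module R C]
    (f : A →ₗ[R] B) (g : B →ₗ[R] C) : Prop :=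
  IsKernel f g ∧ IsCokernel g f

/-- `M` is e-injective: the contravariant functor `Hom_S(-, M)` from left `S`-semimodules to
commutative monoids sends short exact sequences to short exact sequences. Commutative monoids are
`ℕ`-semimodules, and `LinearMap.lcomp ℕ M f` is precomposition with `f`. -/
def EInjective (S : Type w) [Semiring S] (M : Type v) [AddCommMonoid M] [Module S M] : Prop :=
  ∀ (A B C : Type v) [AddCommMonoid A] [AddCommMonoid B] [AddCommMonoid C]
    [Module S A] [Module S B] [Module S C] (f : A →ₗ[S] B) (g : B →ₗ[S] C),
    IsShortExact f g → IsShortExact (LinearMap.lcomp ℕ M g) (LinearMap.lcomp ℕ M f)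

/-- `V(M) = {m | m + m' = 0 for some m'}`, a subsemimodule of `M`. -/
def V (S : Type w) [Semiring S] (M : Type v) [AddCommMonoid M] [Module S M] : Submodule S M where
  carrier := {m | ∃ m', m + m' = 0}
  add_mem' := by
    rintro a b ⟨a', ha⟩ ⟨b', hb⟩
    exact ⟨a' + b', by rw [add_add_add_comm, ha, hb, add_zero]⟩
  zero_mem' := ⟨0, add_zero 0⟩
  smul_mem' := by
    rintro s a ⟨a', ha⟩
    exact ⟨s • a', by rw [← smul_add, ha, smul_zero]⟩

/-- The Bourne congruence of a subsemimodule `L` of `M`: `m ≡ m'` iff `m + l = m' + l'` for some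
`l, l' ∈ L`. The factor semimodule `M / L` is `(bourneCon L).Quotient`. -/
def bourneCon {S : Type w} [Semiring S] {M : Type v} [AddCommMonoid M] [Module S M]
    (L : Submodule S M) : ModuleCon S M where
  r m m' := ∃ l ∈ L, ∃ l' ∈ L, m + l = m' + l'
  iseqv :=
    { refl := fun _ => ⟨0, L.zero_mem, 0, L.zero_mem, rfl⟩
      symm := fun ⟨l, hl, l', hl', h⟩ => ⟨l', hl', l, hl, h.symm⟩
      trans := by
        rintro x y z ⟨a, ha, b, hb, h⟩ ⟨c, hc, d, hd, h'⟩
        refine ⟨a + c, L.add_mem ha hc, b + d, L.add_mem hb hd, ?_⟩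
        rw [← add_assoc, h, add_right_comm, h', add_assoc, add_comm d b] }
  add' := by
    rintro x y z t ⟨a, ha, b, hb, h⟩ ⟨c, hc, d, hd, h'⟩
    exact ⟨a + c, L.add_mem ha hc, b + d, L.add_mem hb hd, by
      rw [add_add_add_comm, h, h', add_add_add_comm]⟩
  smul := by
    rintro s x y ⟨a, ha, b, hb, h⟩
    exact ⟨s • a, L.smul_mem s ha, s • b, L.smul_mem s hb, by rw [← smul_add, h, smul_add]⟩

/-- A ring `R` is quasi-Frobenius: it is left and right Artinian and injective both as a left and
as a right module over itself. Right `R`-modules are modules over `Rᵐᵒᵖ`. -/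
def IsQuasiFrobenius (R : Type u) [Ring R] : Prop :=
  IsArtinian R R ∧ IsArtinian Rᵐᵒᵖ R ∧ Module.Injective R R ∧ Module.Injective Rᵐᵒᵖ R

/-- The semiring `S` is a quasi-Frobenius ring: its addition has negatives, so that it is a ring,
and this ring is quasi-Frobenius. -/
def IsQuasiFrobeniusRing (S : Type u) [inst : Semiring S] : Prop :=
  ∃ R : Ring S, R.toSemiring = inst ∧ @IsQuasiFrobenius S R

end ESemimod

/-! Over a ring, semimodules are modules and e-injective means injective. So the theorem becomes the
Faith–Walker description of quasi-Frobenius rings once (2) and (3) are each shown to force `1 ∈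
V(S)`.

Under (2), a retraction of `S^ℕ` onto the free semimodule `S^(ℕ)` produces a negative of `1`
(`one_mem_V_of_eInjective_finsupp`). Under (3), `S/V(S)` is zero-sum-free, so some `w` in the
e-injective semimodule absorbs the image of `1`. If `w` had a negative, that image would vanish and
`1` would lie in `V(S)`; otherwise the `2^κ` indicator vectors of `w` in the projective semimodule
`M^κ` would be separated by finitely many coordinates, against Cantor
(`one_mem_V_of_eInjective_projective`).

Let `R` be a ring whose injectives are projective. All modules embed in free ones, and the same
counting makes `R` left Noetherian. Injective hulls of simples are "cells", with an essentially
unique simple submodule and simple quotient. This pairing is injective on finitely many isomorphism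
classes, hence onto, so injective left ideals generate `R` and all projectives are injective. If
free modules are injective, ascending chains of left annihilators stabilize and `R` is semiprimary;
the same pairing, read backwards, embeds every simple in `R`, and annihilator duality gives the rest
(`isQuasiFrobenius_of_free_injective`). Conversely, over a quasi-Frobenius ring an injective module
is a summand of a free one into which its socle embeds. -/

namespace ESemimod

/-! ### Short exact sequences in terms of elements. -/

section Exactness

variable {R : Type w} [Semiring R] {A B C : Type v}
  [AddCommMonoid A] [AddCommMonoid B] [AddCommMonoid C] [Module R A] [Module R B] [Module R C]

/-- The canonical projection onto the quotient by a congruence. -/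
def conMk (c : ModuleCon R B) : B →ₗ[R] c.Quotient where
  toFun b := (Quotient.mk c.toSetoid b : c.Quotient)
  map_add' _ _ := rfl
  map_smul' _ _ := rfl

lemma conMk_surjective (c : ModuleCon R B) : Function.Surjective (conMk c) :=
  fun q => Quotient.exists_rep q

lemma conMk_eq_iff {c : ModuleCon R B} {x y : B} : conMk c x = conMk c y ↔ c.r x y :=
  Quotient.eq

/-- A surjection whose fibres are respected by `x` factors `x`. -/
lemma exists_factor {B C X : Type*} [AddCommMonoid B] [Module R B] [AddCommMonoid C] [Module R C]
    [AddCommMonoid X] [Module R X] (c : B →ₗ[R] C)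
    (hc : Function.Surjective c) (x : B →ₗ[R] X) (h : ∀ b b', c b = c b' → x b = x b') :
    ∃ i : C →ₗ[R] X, ∀ b, i (c b) = x b := by
  have key : ∀ b, x (Function.surjInv hc (c b)) = x b := fun b =>
    h _ _ (Function.surjInv_eq hc (c b))
  refine ⟨{ toFun := fun y => x (Function.surjInv hc y), map_add' := ?_, map_smul' := ?_ }, key⟩
  · intro y z
    rw [← map_add]
    exact h _ _ (by simp [Function.surjInv_eq hc])
  · intro s y
    rw [RingHom.id_apply, ← map_smul]
    exact h _ _ (by simp [Function.surjInv_eq hc])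

/-- The universal property is tested on the kernel pair of `f`, whose two projections must agree,
and on `ker g`. -/
lemma isKernel_iff {f : A →ₗ[R] B} {g : B →ₗ[R] C} :
    IsKernel f g ↔ Function.Injective f ∧ ∀ b, g b = 0 ↔ ∃ a, f a = b := by
  constructor
  · rintro ⟨h0, hu⟩
    refine ⟨?_, fun b => ⟨fun hb => ?_, ?_⟩⟩
    · let D : Submodule R (A × A) := LinearMap.eqLocus (f ∘ₗ LinearMap.fst R A A)
        (f ∘ₗ LinearMap.snd R A A)
      let p : D →ₗ[R] A := LinearMap.fst R A A ∘ₗ D.subtype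
      let q : D →ₗ[R] A := LinearMap.snd R A A ∘ₗ D.subtype
      have hpq : f ∘ₗ p = f ∘ₗ q := by
        ext ⟨d, hd⟩
        exact hd
      have hz : g ∘ₗ (f ∘ₗ p) = 0 := by
        rw [← LinearMap.comp_assoc, h0, LinearMap.zero_comp]
      have e : p = q := (hu D (f ∘ₗ p) hz).unique rfl hpq
      intro x y hxy
      exact LinearMap.congr_fun e ⟨(x, y), hxy⟩
    · obtain ⟨i, hi, -⟩ := hu (LinearMap.ker g) (LinearMap.ker g).subtype (by ext x; exact x.2)
      exact ⟨i ⟨b, hb⟩, (LinearMap.congr_fun hi ⟨b, hb⟩).symm⟩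
    · rintro ⟨a, rfl⟩
      exact LinearMap.congr_fun h0 a
  · rintro ⟨hf, hg⟩
    refine ⟨LinearMap.ext fun a => (hg _).2 ⟨a, rfl⟩, fun X _ _ x hx => ?_⟩
    choose i hi using fun t => (hg (x t)).1 (LinearMap.congr_fun hx t)
    refine ⟨{ toFun := i, map_add' := ?_, map_smul' := ?_ }, ?_, ?_⟩
    · exact fun s t => hf (by simp [hi])
    · exact fun s t => hf (by simp [hi])
    · ext t
      exact (hi t).symm
    · intro j hj
      ext t
      apply hf
      change f (j t) = f (i t)
      rw [hi, hj]
      rfl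

/-- The universal property is tested on `range g`, for surjectivity, and on the Bourne quotient by
`range f`, for the fibres. -/
lemma isCokernel_iff {f : A →ₗ[R] B} {g : B →ₗ[R] C} :
    IsCokernel g f ↔ Function.Surjective g ∧
      ∀ b b', g b = g b' ↔ ∃ a a', b + f a = b' + f a' := by
  constructor
  · rintro ⟨h0, hu⟩
    have hgf : ∀ a, g (f a) = 0 := fun a => LinearMap.congr_fun h0 a
    refine ⟨?_, fun b b' => ⟨fun h => ?_, ?_⟩⟩
    · obtain ⟨i, hi, -⟩ := hu (LinearMap.range g) g.rangeRestrict
        (by ext a; exact hgf a)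
      have e : (LinearMap.range g).subtype ∘ₗ i = LinearMap.id := by
        refine (hu C g h0).unique ?_ rfl
        rw [LinearMap.comp_assoc, ← hi]
        rfl
      intro y
      obtain ⟨b, hb⟩ := (i y).2
      exact ⟨b, hb.trans (LinearMap.congr_fun e y)⟩
    · let c := bourneCon (LinearMap.range f)
      obtain ⟨i, hi, -⟩ := hu c.Quotient (conMk c) (by
        ext a
        exact conMk_eq_iff.2 ⟨0, zero_mem _, f a, ⟨a, rfl⟩, by simp⟩)
      have hb : conMk c b = conMk c b' := by
        rw [hi]
        simp [h]
      obtain ⟨_, ⟨a, rfl⟩, _, ⟨a', rfl⟩, e⟩ := conMk_eq_iff.1 hb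
      exact ⟨a, a', e⟩
    · rintro ⟨a, a', e⟩
      simpa [hgf] using congrArg g e
  · rintro ⟨hs, hg⟩
    refine ⟨LinearMap.ext fun a => ?_, fun X _ _ x hx => ?_⟩
    · exact ((hg _ _).2 ⟨0, a, by simp⟩).trans (map_zero g)
    · have hxf : ∀ a, x (f a) = 0 := fun a => LinearMap.congr_fun hx a
      obtain ⟨i, hi⟩ := exists_factor g hs x fun b b' h => by
        obtain ⟨a, a', e⟩ := (hg _ _).1 h
        simpa [hxf] using congrArg x e
      refine ⟨i, LinearMap.ext fun b => (hi b).symm, fun j hj => LinearMap.ext fun y => ?_⟩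
      obtain ⟨b, rfl⟩ := hs y
      rw [hi, hj]
      rfl

/-- An injection with subtractive image is the left part of a short exact sequence. -/
lemma isShortExact_bourne (f : A →ₗ[R] B) (hf : Function.Injective f)
    (hsub : ∀ a a' b, b + f a = f a' → ∃ a'', f a'' = b) :
    IsShortExact f (conMk (bourneCon (LinearMap.range f))) := by
  refine ⟨isKernel_iff.2 ⟨hf, fun b => ?_⟩, isCokernel_iff.2 ⟨conMk_surjective _, fun b b' => ?_⟩⟩
  · rw [← map_zero (conMk (bourneCon (LinearMap.range f))), conMk_eq_iff]
    constructor
    · rintro ⟨_, ⟨a, rfl⟩, _, ⟨a', rfl⟩, e⟩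
      exact hsub a a' b (by rw [e, zero_add])
    · rintro ⟨a, rfl⟩
      exact ⟨0, zero_mem _, f a, ⟨a, rfl⟩, by simp⟩
  · rw [conMk_eq_iff]
    constructor
    · rintro ⟨_, ⟨a, rfl⟩, _, ⟨a', rfl⟩, e⟩
      exact ⟨a, a', e⟩
    · rintro ⟨a, a', e⟩
      exact ⟨_, ⟨a, rfl⟩, _, ⟨a', rfl⟩, e⟩

end Exactness

/-! ### e-injective semimodules. -/

section EInjective

variable {S : Type u} [Semiring S]

/-- The kernel half of exactness of `Hom(-, M)` follows from `g` being a cokernel; only the cokernel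
half is a condition on `M`. -/
lemma eInjective_iff {M : Type u} [AddCommMonoid M] [Module S M] :
    EInjective S M ↔ ∀ (A B C : Type u) [AddCommMonoid A] [AddCommMonoid B] [AddCommMonoid C]
      [Module S A] [Module S B] [Module S C] (f : A →ₗ[S] B) (g : B →ₗ[S] C), IsShortExact f g →
      (∀ h : A →ₗ[S] M, ∃ h' : B →ₗ[S] M, h' ∘ₗ f = h) ∧
      ∀ h h' : B →ₗ[S] M, h ∘ₗ f = h' ∘ₗ f →
        ∃ k k' : C →ₗ[S] M, h + k ∘ₗ g = h' + k' ∘ₗ g := by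
  constructor
  · intro H A B C _ _ _ _ _ _ f g hfg
    obtain ⟨h1, h2⟩ := isCokernel_iff.1 (H A B C f g hfg).2
    exact ⟨h1, fun h h' e => (h2 h h').1 e⟩
  · intro H A B C _ _ _ _ _ _ f g hfg
    obtain ⟨h1, h2⟩ := H A B C f g hfg
    obtain ⟨hgs, hg⟩ := isCokernel_iff.1 hfg.2
    have hgf : g ∘ₗ f = 0 := hfg.2.1
    refine ⟨isKernel_iff.2 ⟨fun i j e => ?_, fun x => ⟨fun hx => ?_, ?_⟩⟩,
      isCokernel_iff.2 ⟨h1, fun h h' => ⟨h2 h h', ?_⟩⟩⟩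
    · ext y
      obtain ⟨b, rfl⟩ := hgs y
      exact LinearMap.congr_fun e b
    · obtain ⟨i, hi, -⟩ := hfg.2.2 M x hx
      exact ⟨i, hi.symm⟩
    · rintro ⟨i, rfl⟩
      change (i ∘ₗ g) ∘ₗ f = 0
      rw [LinearMap.comp_assoc, hgf, LinearMap.comp_zero]
    · rintro ⟨k, k', e⟩
      have hk : ∀ k : C →ₗ[S] M, (k ∘ₗ g) ∘ₗ f = 0 := fun k => by
        rw [LinearMap.comp_assoc, hgf, LinearMap.comp_zero]
      have e' : (h + k ∘ₗ g) ∘ₗ f = (h' + k' ∘ₗ g) ∘ₗ f := congrArg (· ∘ₗ f) e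
      rw [LinearMap.add_comp, LinearMap.add_comp, hk, hk, add_zero, add_zero] at e'
      exact e'

/-- Maps into an e-injective semimodule extend along injections with subtractive image. -/
lemma EInjective.exists_extend {M A B : Type u} [AddCommMonoid M] [Module S M] [AddCommMonoid A]
    [AddCommMonoid B] [Module S A] [Module S B] (hM : EInjective S M) (f : A →ₗ[S] B)
    (hf : Function.Injective f) (hsub : ∀ a a' b, b + f a = f a' → ∃ a'', f a'' = b)
    (h : A →ₗ[S] M) : ∃ h' : B →ₗ[S] M, ∀ a, h' (f a) = h a := by
  obtain ⟨h', e⟩ := (eInjective_iff.1 hM _ _ _ f _ (isShortExact_bourne f hf hsub)).1 h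
  exact ⟨h', fun a => LinearMap.congr_fun e a⟩

lemma EInjective.pi {M ι : Type u} [AddCommMonoid M] [Module S M] (hM : EInjective S M) :
    EInjective S (ι → M) := by
  rw [eInjective_iff] at hM ⊢
  intro A B C _ _ _ _ _ _ f g hfg
  obtain ⟨h1, h2⟩ := hM A B C f g hfg
  refine ⟨fun h => ?_, fun h h' e => ?_⟩
  · choose h' hh' using fun i => h1 (LinearMap.proj i ∘ₗ h)
    refine ⟨LinearMap.pi h', LinearMap.ext fun a => funext fun i => ?_⟩
    exact LinearMap.congr_fun (hh' i) a
  · choose k k' hk using fun i => h2 (LinearMap.proj i ∘ₗ h) (LinearMap.proj i ∘ₗ h')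
      (by rw [LinearMap.comp_assoc, e, LinearMap.comp_assoc])
    refine ⟨LinearMap.pi k, LinearMap.pi k', LinearMap.ext fun b => funext fun i => ?_⟩
    exact LinearMap.congr_fun (hk i) b

lemma eInjective_punit : EInjective S PUnit.{u + 1} := by
  rw [eInjective_iff]
  intro A B C _ _ _ _ _ _ f g _
  exact ⟨fun h => ⟨0, LinearMap.ext fun _ => rfl⟩,
    fun h h' _ => ⟨0, 0, LinearMap.ext fun _ => rfl⟩⟩

/-- Over a ring, e-injective semimodules are the injective modules. -/
lemma eInjective_iff_injective {R : Type u} [Ring R] {M : Type u} [AddCommGroup M] [Module R M] :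
    EInjective R M ↔ Module.Injective R M := by
  constructor
  · intro hM
    refine ⟨fun X Y _ _ _ _ f hf h => hM.exists_extend f hf (fun a a' b e => ⟨a' - a, ?_⟩) h⟩
    rw [map_sub, ← e, add_sub_cancel_right]
  · intro hM
    rw [eInjective_iff]
    intro A B C _ _ _ _ _ _ f g hfg
    let _ : AddCommGroup A := Module.addCommMonoidToAddCommGroup R
    let _ : AddCommGroup B := Module.addCommMonoidToAddCommGroup R
    obtain ⟨hf, -⟩ := isKernel_iff.1 hfg.1
    refine ⟨fun h => ?_, fun h h' e => ?_⟩
    · obtain ⟨h', hh'⟩ := hM.out f hf h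
      exact ⟨h', LinearMap.ext hh'⟩
    · obtain ⟨k, hk, -⟩ := hfg.2.2 M (h' - h) (by rw [LinearMap.sub_comp, e, sub_self])
      exact ⟨k, 0, by rw [← hk, LinearMap.zero_comp]; abel⟩

end EInjective

end ESemimod

/-- For a finite set `F`, there are fewer functions `F → X` than sets of sequences in `X`. -/
lemma not_injective_set_seq_to_finset {X : Type u} [Nonempty X] {ι : Type v} (F : Finset ι)
    (g : Set (ℕ → X) → F → X) : ¬ Function.Injective g := by
  intro hg
  let x₀ : X := Classical.arbitrary X
  -- Padding with `x₀` embeds `F → X` into `ℕ → X`, so Cantor's theorem applies.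
  let k : (F → X) → ℕ → X := fun a n => if h : n < F.card then a (F.equivFin.symm ⟨n, h⟩) else x₀
  have hk : Function.Injective k := fun a b e => funext fun i => by
    simpa [k] using congrFun e (F.equivFin i)
  exact Function.cantor_injective _ (hk.comp hg)

/-! ### Each of conditions (2) and (3) makes the semiring a ring. -/

namespace ESemimod

variable {S : Type u} [Semiring S]

lemma V_of_add {M : Type v} [AddCommMonoid M] [Module S M] {x y : M} (h : x + y ∈ V S M) :
    x ∈ V S M := by
  obtain ⟨z, hz⟩ := h
  exact ⟨y + z, by rw [← add_assoc, hz]⟩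

lemma mem_V_of_bourne {M : Type v} [AddCommMonoid M] [Module S M] {x y : M}
    (h : (bourneCon (V S M)).r x y) (hy : y ∈ V S M) : x ∈ V S M := by
  obtain ⟨a, -, b, hb, e⟩ := h
  exact V_of_add (y := a) (e ▸ add_mem hy hb)

lemma bourne_of_mem_V {M : Type v} [AddCommMonoid M] [Module S M] {x y : M}
    (hx : x ∈ V S M) (hy : y ∈ V S M) : (bourneCon (V S M)).r x y :=
  ⟨y, hy, x, hx, add_comm x y⟩

/-- A semiring in which `1` has an additive inverse is a ring. -/
lemma exists_ring_of_one_mem_V (S : Type u) [inst : Semiring S] (h : (1 : S) ∈ V S S) :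
    ∃ R : Ring S, R.toSemiring = inst := by
  obtain ⟨y, hy⟩ := h
  let R : Ring S :=
    { inst with
      neg := fun s => y * s
      zsmul := @zsmulRec S _ _ ⟨fun s => y * s⟩ nsmulRec
      neg_add_cancel := fun s => by
        change y * s + s = 0
        rw [add_comm]
        simpa [add_mul] using congrArg (· * s) hy }
  exact ⟨R, rfl⟩

/-- If the free semimodule of countable rank is e-injective, then the semiring is a ring. -/
lemma one_mem_V_of_eInjective_finsupp (h : EInjective S (ULift.{u} ℕ →₀ S)) :
    (1 : S) ∈ V S S := by
  let f : (ULift.{u} ℕ →₀ S) →ₗ[S] (ULift.{u} ℕ → S) := Finsupp.lcoeFun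
  -- `r` is a retraction; the image of `f` is subtractive because `b + a = a'` bounds the support of
  -- `b`.
  obtain ⟨r, hr⟩ := h.exists_extend f DFunLike.coe_injective (fun a a' b e => by
    have hb : (Function.support b).Finite := by
      refine (a'.support.finite_toSet.union a.support.finite_toSet).subset fun i hi => ?_
      by_contra hcon
      simp only [Set.mem_union, Finset.mem_coe, Finsupp.mem_support_iff, not_or, not_not] at hcon
      have := congrFun e i
      change b i + a i = a' i at this
      rw [hcon.1, hcon.2, add_zero] at this
      exact hi this
    exact ⟨Finsupp.ofSupportFinite b hb, rfl⟩) LinearMap.id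
  -- Splitting `1` as the `i`-th unit vector plus the rest, the `i`-th coordinate of `r 1 = 0` there
  -- reads `1 + _ = 0`.
  obtain ⟨i, hi⟩ := Infinite.exists_notMem_finset (r 1).support
  classical
  have e : f (Finsupp.single i 1) + Function.update (1 : ULift.{u} ℕ → S) i 0 = 1 := by
    funext j
    change Finsupp.single i (1 : S) j + Function.update (1 : ULift.{u} ℕ → S) i 0 j = 1
    obtain rfl | hj := eq_or_ne j i
    · simp
    · simp [hj]
  have e' := congrArg (fun z => r z i) e
  simp only [map_add, hr, Finsupp.notMem_support_iff.1 hi, Finsupp.add_apply,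
    LinearMap.id_apply, Finsupp.single_eq_same] at e'
  exact ⟨_, e'⟩

/-- For a zero-sum-free semimodule `C`, the congruence on
`C × C` identifying `(c, d)` and `(c', d)` whenever every scalar killing `d` identifies `c`
and `c'`. -/
def absorbCon (C : Type v) [AddCommMonoid C] [Module S C] (hC : ∀ x y : C, x + y = 0 → x = 0) :
    ModuleCon S (C × C) where
  r x y := x.2 = y.2 ∧ ∀ s : S, s • x.2 = 0 → s • x.1 = s • y.1
  iseqv :=
    { refl := fun _ => ⟨rfl, fun _ _ => rfl⟩
      symm := fun ⟨h, h'⟩ => ⟨h.symm, fun s hs => (h' s (h ▸ hs)).symm⟩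
      trans := fun ⟨h, h'⟩ ⟨k, k'⟩ => ⟨h.trans k, fun s hs => (h' s hs).trans (k' s (h ▸ hs))⟩ }
  add' := by
    rintro x y z t ⟨h, h'⟩ ⟨k, k'⟩
    refine ⟨by simp [h, k], fun s hs => ?_⟩
    simp only [Prod.snd_add, Prod.fst_add, smul_add] at hs ⊢
    -- Zero-sum-freeness is what lets a scalar killing the sum of second components kill each of
    -- them.
    rw [h' s (hC _ _ hs), k' s (hC _ _ ((add_comm _ _).trans hs))]
  smul := by
    rintro t x y ⟨h, h'⟩
    refine ⟨by simp [h], fun s hs => ?_⟩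
    simp only [Prod.smul_snd, Prod.smul_fst, smul_smul] at hs ⊢
    exact h' _ hs

/-- Images in an e-injective semimodule `M` of elements of a zero-sum-free semimodule are absorbed
by elements of `M`. -/
lemma EInjective.exists_absorbing {M C : Type u} [AddCommMonoid M] [Module S M] [AddCommMonoid C]
    [Module S C] (hM : EInjective S M) (hC : ∀ x y : C, x + y = 0 → x = 0) (φ : C →ₗ[S] M)
    (c : C) : ∃ w : M, φ c + w = w := by
  let p := conMk (absorbCon (S := S) C hC)
  have hp : ∀ x y, p x = p y ↔ x.2 = y.2 ∧ ∀ s : S, s • x.2 = 0 → s • x.1 = s • y.1 :=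
    fun x y => conMk_eq_iff
  -- `C` stays embedded as the first factor (take `s = 1`), yet `(c, 0) + (0, c)` becomes `(0, c)`;
  -- `w` is the image of `(0, c)`.
  obtain ⟨h, hh⟩ := hM.exists_extend (p ∘ₗ LinearMap.inl S C C)
    (fun a b e => by simpa using ((hp _ _).1 e).2 1 (by simp))
    (fun a a' b e => by
      obtain ⟨⟨x, y⟩, rfl⟩ := conMk_surjective _ b
      change p (x, y) + p (a, 0) = p (a', 0) at e
      rw [← map_add, hp] at e
      have hy : y = 0 := by simpa using e.1
      subst hy
      exact ⟨x, rfl⟩) φ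
  refine ⟨h (p (0, c)), ?_⟩
  rw [← hh, ← map_add]
  congr 1
  change p (c, 0) + p (0, c) = p (0, c)
  rw [← map_add, hp]
  refine ⟨by simp, fun s hs => ?_⟩
  simpa using hs

/-- If all e-injective semimodules are projective and `S / V(S)` embeds in an e-injective one,
then `S` is a ring. -/
lemma one_mem_V_of_eInjective_projective
    (H : ∀ (M : Type u) [AddCommMonoid M] [Module S M], EInjective S M → Module.Projective S M)
    {M : Type u} [AddCommMonoid M] [Module S M] (hM : EInjective S M)
    (φ : (bourneCon (V S S)).Quotient →ₗ[S] M) (hφ : Function.Injective φ) :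
    (1 : S) ∈ V S S := by
  let c := bourneCon (V S S)
  have hzero : ∀ x : S, conMk c x = 0 ↔ x ∈ V S S := fun x => by
    rw [← map_zero (conMk c), conMk_eq_iff]
    exact ⟨fun h => mem_V_of_bourne h (zero_mem _), fun h => bourne_of_mem_V h (zero_mem _)⟩
  obtain ⟨w, hw⟩ := hM.exists_absorbing (fun x y e => by
    obtain ⟨x, rfl⟩ := conMk_surjective _ x
    obtain ⟨y, rfl⟩ := conMk_surjective _ y
    rw [← map_add, hzero] at e
    exact (hzero x).2 (V_of_add e)) φ (conMk c 1)
  by_cases hwV : w ∈ V S M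
  · obtain ⟨w', hw'⟩ := hwV
    have h0 : φ (conMk c 1) = 0 := by
      have := congrArg (· + w') hw
      simpa only [add_assoc, hw', add_zero] using this
    exact (hzero 1).1 (hφ (h0.trans (map_zero φ).symm))
  exfalso
  -- `κ` is so large that its power set exceeds the set of maps from any finite set to `c.Quotient`.
  let κ := ℕ → c.Quotient
  obtain ⟨s, hs⟩ := (H (κ → M) hM.pi).out
  classical
  let e : Set κ → κ → M := fun T i => if i ∈ T then w else 0
  let z : Set κ → (κ → M) →₀ S := fun T => s (e T)
  -- Hence outside the finite support of `z Set.univ` all coordinates of `z T` have negatives and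
  -- vanish modulo `V(S)`.
  have hadd : ∀ T, z T + z Tᶜ = z Set.univ := fun T => by
    change s _ + s _ = s _
    rw [← map_add]
    congr 1
    funext i
    by_cases hi : i ∈ T <;> simp [e, hi]
  refine not_injective_set_seq_to_finset (z Set.univ).support
    (fun T j => conMk c (z T j.1)) fun T T' hTT' => ?_
  have hz : ∀ j, conMk c (z T j) = conMk c (z T' j) := fun j => by
    by_cases hj : j ∈ (z Set.univ).support
    · exact congrFun hTT' ⟨j, hj⟩
    · have hV : ∀ T, conMk c (z T j) = 0 := fun T => (hzero _).2 ⟨z Tᶜ j, by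
        rw [← Finsupp.add_apply, hadd, Finsupp.notMem_support_iff.1 hj]⟩
      rw [hV, hV]
  let d := bourneCon (V S (κ → M))
  -- `e T` is the combination with coefficients `z T`, so coefficients equal modulo `V(S)` give
  -- vectors equal modulo `V(M^κ)`.
  have hd : conMk d (e T) = conMk d (e T') := by
    rw [← hs (e T), ← hs (e T'), Finsupp.linearCombination_apply, Finsupp.linearCombination_apply,
      Finsupp.sum_of_support_subset (s := (z T).support ∪ (z T').support) _
        Finset.subset_union_left _ (by simp),
      Finsupp.sum_of_support_subset (s := (z T).support ∪ (z T').support) _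
        Finset.subset_union_right _ (by simp), map_sum, map_sum]
    refine Finset.sum_congr rfl fun j _ => ?_
    obtain ⟨v, ⟨n, hn⟩, v', ⟨n', hn'⟩, hv⟩ := conMk_eq_iff.1 (hz j)
    refine conMk_eq_iff.2 ⟨v • j, ⟨n • j, ?_⟩, v' • j, ⟨n' • j, ?_⟩, ?_⟩
    · rw [← add_smul, hn, zero_smul]
    · rw [← add_smul, hn', zero_smul]
    · rw [id, ← add_smul, hv, add_smul]
  obtain ⟨m, ⟨n, hn⟩, m', ⟨n', hn'⟩, hm⟩ := conMk_eq_iff.1 hd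
  ext i
  by_contra hcon
  apply hwV
  have hmi := congrFun hm i
  have hni := congrFun hn i
  have hni' := congrFun hn' i
  simp only [Pi.add_apply, Pi.zero_apply] at hmi hni hni'
  by_cases hi : i ∈ T
  · have hi' : i ∉ T' := fun h => hcon (by simp [hi, h])
    simp only [e, hi, hi', if_true, if_false, zero_add] at hmi
    exact ⟨m i + n' i, by rw [← add_assoc, hmi, hni']⟩
  · have hi' : i ∈ T' := by_contra fun h => hcon (by simp [hi, h])
    simp only [e, hi, hi', if_true, if_false, zero_add] at hmi
    exact ⟨m' i + n i, by rw [← add_assoc, ← hmi, hni]⟩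

variable {R : Type u} [Ring R]

/-! ### Injective modules: direct sums and essential summands. -/

section Injective

lemma injective_of_retract {M N : Type u} [AddCommGroup M] [Module R M] [AddCommGroup N]
    [Module R N] (hM : Module.Injective R M) (i : N →ₗ[R] M) (r : M →ₗ[R] N)
    (h : ∀ x, r (i x) = x) : Module.Injective R N := by
  refine ⟨fun X Y _ _ _ _ f hf g => ?_⟩
  obtain ⟨k, hk⟩ := hM.out f hf (i ∘ₗ g)
  exact ⟨r ∘ₗ k, fun x => by simp [hk, h]⟩

lemma exists_injective_embedding (M : Type u) [AddCommGroup M] [Module R M] :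
    ∃ (E : Type u) (_ : AddCommGroup E) (_ : Module R E), Module.Injective R E ∧
      ∃ f : M →ₗ[R] E, Function.Injective f := by
  obtain ⟨⟨J, hJ, f, hf⟩⟩ := (ModuleCat.enoughInjectives R).presentation (ModuleCat.of R M)
  exact ⟨J, inferInstance, inferInstance, Module.injective_module_of_injective_object R J,
    f.hom, (ModuleCat.mono_iff_injective f).1 hf⟩

/-- Over a left Noetherian ring, direct sums of injective modules are injective. -/
lemma injective_dfinsupp [IsNoetherianRing R] {ι : Type u} (M : ι → Type u)
    [∀ i, AddCommGroup (M i)] [∀ i, Module R (M i)] (hM : ∀ i, Module.Injective R (M i)) :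
    Module.Injective R (Π₀ i, M i) := by
  classical
  refine Module.Baer.injective fun I g => ?_
  obtain ⟨y, hy⟩ := Module.Baer.of_injective (Module.Injective.pi R M) I
    (DFinsupp.coeFnLinearMap R ∘ₗ g)
  obtain ⟨s, hs⟩ := (isNoetherianRing_iff_ideal_fg R).1 inferInstance I
  have hsI : ∀ x ∈ s, x ∈ I := fun x hx => hs ▸ Submodule.subset_span hx
  -- `y` extends `g` into the full product; as `I` is finitely generated, `g` lives on the finite
  -- set `F`, to which `y 1` may be truncated.
  let F : Finset ι := s.attach.biUnion fun x => (g ⟨x, hsI x x.2⟩).support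
  have hF : ∀ x : R, ∀ hx : x ∈ I, ∀ j ∉ F, g ⟨x, hx⟩ j = 0 := by
    intro x hx j hj
    have hle : I ≤ Submodule.map I.subtype
        (LinearMap.ker ((DFinsupp.lapply j : (Π₀ i, M i) →ₗ[R] M j) ∘ₗ g)) := by
      refine hs.symm.le.trans (Submodule.span_le.2 fun x hx => ?_)
      refine ⟨⟨x, hsI x hx⟩, ?_, rfl⟩
      by_contra hne
      exact hj (Finset.mem_biUnion.2 ⟨⟨x, hx⟩, Finset.mem_attach _ _,
        DFinsupp.mem_support_toFun _ _ |>.2 hne⟩)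
    obtain ⟨z, hz, rfl⟩ := hle hx
    exact hz
  refine ⟨LinearMap.toSpanSingleton R _ (DFinsupp.mk F fun i => y 1 i), fun x hx => ?_⟩
  ext j
  by_cases hj : j ∈ F
  · have := congrFun (hy x hx) j
    have hyx : y x = x • y 1 := by rw [← map_smul, smul_eq_mul, mul_one]
    rw [hyx] at this
    simpa [DFinsupp.mk_apply, hj] using this
  · simp [hj, hF x hx j hj]

lemma injective_finsupp_of_noetherian [IsNoetherianRing R] (h : Module.Injective R R)
    (ι : Type u) : Module.Injective R (ι →₀ R) := by
  classical
  let e := finsuppLequivDFinsupp (ι := ι) (M := R) R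
  exact injective_of_retract (injective_dfinsupp (fun _ : ι => R) fun _ => h)
    e.toLinearMap e.symm.toLinearMap fun x => e.symm_apply_apply x

lemma injective_of_projective (h : ∀ ι : Type u, Module.Injective R (ι →₀ R)) (P : Type u)
    [AddCommGroup P] [Module R P] (hP : Module.Projective R P) : Module.Injective R P := by
  obtain ⟨s, hs⟩ := hP.out
  exact injective_of_retract (h P) s _ hs

lemma injective_of_isCompl {M : Type u} [AddCommGroup M] [Module R M]
    (hM : Module.Injective R M) {E K : Submodule R M} (h : IsCompl E K) :
    Module.Injective R E :=
  injective_of_retract hM E.subtype (E.projectionOnto K h) fun x =>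
    Submodule.projectionOnto_apply_left h x

/-- Every submodule of an injective module is essential in some direct summand. -/
lemma exists_essential_summand {M : Type u} [AddCommGroup M] [Module R M]
    (hM : Module.Injective R M) (N : Submodule R M) :
    ∃ E K : Submodule R M, N ≤ E ∧ IsCompl E K ∧
      ∀ x ∈ E, x ≠ 0 → ∃ r : R, r • x ∈ N ∧ r • x ≠ 0 := by
  obtain ⟨E, hNE, ⟨⟨-, hE⟩, hmax⟩⟩ := zorn_le_nonempty₀
    {E : Submodule R M | N ≤ E ∧ ∀ x ∈ E, x ≠ 0 → ∃ r : R, r • x ∈ N ∧ r • x ≠ 0}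
    (fun c hc hchain y hy => ⟨sSup c, ⟨(hc hy).1.trans (le_sSup hy), fun x hx hx0 => by
      obtain ⟨E, hE, hxE⟩ := (Submodule.mem_sSup_of_directed ⟨y, hy⟩ hchain.directedOn).1 hx
      exact (hc hE).2 x hxE hx0⟩, fun z hz => le_sSup hz⟩)
    N ⟨le_rfl, fun x hx hx0 => ⟨1, by simpa using hx, by simpa using hx0⟩⟩
  obtain ⟨K, -, ⟨hKE, hKmax⟩⟩ := zorn_le_nonempty₀ {K : Submodule R M | Disjoint K E}
    (fun c hc hchain y hy => ⟨sSup c, by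
      change Disjoint _ _
      rw [Submodule.disjoint_def]
      intro x hx hxE
      obtain ⟨K, hK, hxK⟩ := (Submodule.mem_sSup_of_directed ⟨y, hy⟩ hchain.directedOn).1 hx
      exact (Submodule.disjoint_def.1 (hc hK)) x hxK hxE, fun z hz => le_sSup hz⟩)
    ⊥ disjoint_bot_left
  have hinj : Function.Injective (K.mkQ ∘ₗ E.subtype) := by
    rw [← LinearMap.ker_eq_bot, LinearMap.ker_eq_bot']
    rintro ⟨x, hx⟩ h
    have hxK : x ∈ K := by simpa using h
    exact Subtype.ext (Submodule.disjoint_def.1 hKE x hxK hx)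
  -- `E` is a maximal essential extension of `N` in `M`, and `K` is maximal with `K ∩ E = 0`, so `E`
  -- is essential in `M ⧸ K`. Then `range ψ` is essential over `N`, hence equals `E`, and `ψ ∘
  -- K.mkQ` projects onto `E` along `K`.
  obtain ⟨ψ, hψ⟩ := hM.out _ hinj E.subtype
  have hess : ∀ q : M ⧸ K, q ≠ 0 → ∃ (r : R) (e : E), K.mkQ e = r • q ∧ e ≠ 0 := by
    intro q hq
    obtain ⟨x, rfl⟩ := K.mkQ_surjective q
    have hxK : x ∉ K := fun h => hq (by simpa using h)
    have hnd : ¬ Disjoint (K ⊔ Submodule.span R {x}) E := fun hd =>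
      hxK (hKmax hd le_sup_left (Submodule.mem_sup_right (Submodule.mem_span_singleton_self x)))
    rw [Submodule.disjoint_def] at hnd
    push Not at hnd
    obtain ⟨e, he, heE, he0⟩ := hnd
    obtain ⟨k, hk, t, ht, rfl⟩ := Submodule.mem_sup.1 he
    obtain ⟨r, rfl⟩ := Submodule.mem_span_singleton.1 ht
    refine ⟨r, ⟨_, heE⟩, ?_, fun h => he0 (congrArg Subtype.val h)⟩
    have : K.mkQ k = 0 := by simpa using hk
    rw [map_add, this, zero_add, map_smul]
  have hEψ : E ≤ LinearMap.range ψ := fun x hx => ⟨_, hψ ⟨x, hx⟩⟩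
  have hrange : LinearMap.range ψ ≤ E := by
    refine hmax ⟨hNE.trans hEψ, ?_⟩ hEψ
    rintro _ ⟨q, rfl⟩ hq
    obtain ⟨r, e, he, he0⟩ := hess q (fun h => hq (by rw [h, map_zero]))
    obtain ⟨s, hs, hs0⟩ := hE e e.2 (fun h => he0 (Subtype.ext h))
    have : (s * r) • ψ q = s • (e : M) := by
      rw [mul_smul, ← map_smul, ← he]
      exact congrArg (s • ·) (hψ e)
    exact ⟨s * r, this ▸ hs, this ▸ hs0⟩
  have hψinj : ∀ q, ψ q = 0 → q = 0 := by
    intro q hq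
    by_contra hq0
    obtain ⟨r, e, he, he0⟩ := hess q hq0
    have := hψ e
    simp only [LinearMap.comp_apply, Submodule.subtype_apply] at this
    rw [he, map_smul, hq, smul_zero] at this
    exact he0 (Subtype.ext this.symm)
  refine ⟨E, K, hNE, ⟨hKE.symm, codisjoint_iff.2 (eq_top_iff.2 fun x _ => ?_)⟩, hE⟩
  have hxE := hrange ⟨K.mkQ x, rfl⟩
  have hx : K.mkQ x - K.mkQ (ψ (K.mkQ x)) = 0 := by
    apply hψinj
    have := hψ ⟨_, hxE⟩
    simp only [LinearMap.comp_apply, Submodule.subtype_apply] at this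
    rw [map_sub, this, sub_self]
  rw [← map_sub] at hx
  have hxK : x - ψ (K.mkQ x) ∈ K := (Submodule.Quotient.mk_eq_zero K).1 hx
  exact Submodule.mem_sup.2 ⟨_, hxE, _, hxK, by abel⟩

end Injective

/-! ### Cells, their simple submodules and their simple quotients. -/

section Cells

variable {E E' U U' : Type u} [AddCommGroup E] [Module R E] [AddCommGroup E'] [Module R E']
  [AddCommGroup U] [Module R U] [AddCommGroup U'] [Module R U']

/-- Any two nonzero elements have a common nonzero multiple. -/
def IsUniform (R : Type u) [Ring R] (E : Type u) [AddCommGroup E] [Module R E] : Prop :=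
  ∀ x y : E, x ≠ 0 → y ≠ 0 → ∃ r s : R, r • x = s • y ∧ r • x ≠ 0

/-- An injective projective uniform module all of whose noninjective endomorphisms are
nilpotent. -/
structure IsCell (R : Type u) [Ring R] (E : Type u) [AddCommGroup E] [Module R E] : Prop where
  injective : Module.Injective R E
  projective : Module.Projective R E
  uniform : IsUniform R E
  nilpotent : ∀ f : Module.End R E, ¬ Function.Injective f → IsNilpotent f

/-- If `f ^ n ≠ 0`, a nonzero value of it and a nonzero element of `ker f` share a nonzero multiple,
which lies in both `range (f ^ n)` and `ker (f ^ n)`. -/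
lemma IsUniform.isNilpotent (hE : IsUniform R E) (f : Module.End R E)
    (hf : ¬ Function.Injective f) (n : ℕ) (hn : n ≠ 0)
    (hker : ∀ x, (f ^ n) ((f ^ n) x) = 0 → (f ^ n) x = 0) : IsNilpotent f := by
  refine ⟨n, LinearMap.ext fun x => ?_⟩
  by_contra hx
  rw [← LinearMap.ker_eq_bot, LinearMap.ker_eq_bot'] at hf
  push Not at hf
  obtain ⟨y, hy, hy0⟩ := hf
  obtain ⟨r, s, e, hne⟩ := hE _ y hx hy0
  have hny : (f ^ n) y = 0 := by
    obtain ⟨m, rfl⟩ := Nat.exists_eq_succ_of_ne_zero hn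
    rw [pow_succ, Module.End.mul_apply, hy, map_zero]
  rw [← map_smul] at e hne
  exact hne (hker _ (by rw [e, map_smul, hny, smul_zero]))

lemma IsUniform.isNilpotent_of_noetherian [IsNoetherian R E] (hE : IsUniform R E)
    (f : Module.End R E) (hf : ¬ Function.Injective f) : IsNilpotent f := by
  obtain ⟨n, hn, hn0⟩ := ((Module.End.eventually_disjoint_ker_pow_range_pow f).and
    (Filter.eventually_ne_atTop 0)).exists
  exact hE.isNilpotent f hf n hn0 fun x hx =>
    Submodule.disjoint_def.1 hn _ hx ⟨x, rfl⟩

/-- A map out of a uniform module that is nonzero on some submodule mapped injectively is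
injective. -/
lemma IsUniform.injective_of_comp [Nontrivial U] (hE : IsUniform R E) (f : E →ₗ[R] E')
    (i : U →ₗ[R] E) (h : Function.Injective (f ∘ₗ i)) : Function.Injective f := by
  rw [← LinearMap.ker_eq_bot, LinearMap.ker_eq_bot']
  intro x hx
  by_contra hx0
  obtain ⟨u, hu⟩ := exists_ne (0 : U)
  have hiu : i u ≠ 0 := fun h0 => hu (h (by simp [h0]))
  obtain ⟨r, s, e, hne⟩ := hE x (i u) hx0 hiu
  have : (f ∘ₗ i) (s • u) = 0 := by
    rw [LinearMap.comp_apply, map_smul, ← e, map_smul, hx, smul_zero]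
  have hsu : s • u = 0 := h (this.trans (map_zero _).symm)
  exact hne (by rw [e, ← map_smul, hsu, map_zero])

/-- A retraction of `f` is injective on the image of `E`, hence on all of the uniform `E'`. -/
lemma surjective_of_injective [Nontrivial E] (hE : Module.Injective R E) (hE' : IsUniform R E')
    (f : E →ₗ[R] E') (hf : Function.Injective f) : Function.Surjective f := by
  obtain ⟨r, hr⟩ := hE.out f hf LinearMap.id
  have hri : Function.Injective r := hE'.injective_of_comp r f (by
    intro x y h
    simpa [hr] using h)
  exact fun y => ⟨r y, hri (by simp [hr])⟩

lemma nontrivial_of_surjective [IsSimpleModule R U] (p : E →ₗ[R] U) (hp : Function.Surjective p) :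
    Nontrivial E :=
  have := IsSimpleModule.nontrivial R U
  hp.nontrivial

/-- Otherwise `f` is nilpotent and `p = p ∘ f ^ n = 0`. -/
lemma IsCell.injective_of_comp_eq [IsSimpleModule R U] (hE : IsCell R E) (p : E →ₗ[R] U)
    (hp : Function.Surjective p) (f : Module.End R E) (h : ∀ x, p (f x) = p x) :
    Function.Injective f := by
  by_contra hf
  obtain ⟨n, hn⟩ := hE.nilpotent f hf
  have hpow : ∀ n x, p ((f ^ n) x) = p x := by
    intro n
    induction n with
    | zero => simp
    | succ n ih => intro x; rw [pow_succ', Module.End.mul_apply, h, ih]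
  have := IsSimpleModule.nontrivial R U
  obtain ⟨u, hu⟩ := exists_ne (0 : U)
  obtain ⟨x, rfl⟩ := hp u
  exact hu (by rw [← hpow n x, hn, LinearMap.zero_apply, map_zero])

/-- If `p` were nonzero on `ker q` it would be onto there. Lifting `p` gives an endomorphism `f`
into `ker q` with `p ∘ f = p`; it is injective, hence onto, so `q = 0`. -/
lemma IsCell.ker_le_ker [IsSimpleModule R U] [IsSimpleModule R U']
    (hE : IsCell R E) (p : E →ₗ[R] U) (hp : Function.Surjective p) (q : E →ₗ[R] U')
    (hq : Function.Surjective q) : LinearMap.ker q ≤ LinearMap.ker p := by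
  have := nontrivial_of_surjective p hp
  by_contra hle
  have hne : p ∘ₗ (LinearMap.ker q).subtype ≠ 0 := fun h0 =>
    hle fun x hx => LinearMap.congr_fun h0 ⟨x, hx⟩
  have hs := LinearMap.surjective_of_ne_zero hne
  have := hE.projective
  obtain ⟨h, hh⟩ := Module.projective_lifting_property _ p hs
  let f : Module.End R E := (LinearMap.ker q).subtype ∘ₗ h
  have hf := hE.injective_of_comp_eq p hp f fun x => LinearMap.congr_fun hh x
  have hfs := surjective_of_injective hE.injective hE.uniform f hf
  have := IsSimpleModule.nontrivial R U'
  obtain ⟨u, hu⟩ := exists_ne (0 : U')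
  obtain ⟨x, rfl⟩ := hq u
  obtain ⟨y, rfl⟩ := hfs x
  exact hu (h y).2

/-- A cell has at most one simple quotient. -/
lemma IsCell.nonempty_equiv_of_surjective [IsSimpleModule R U] [IsSimpleModule R U']
    (hE : IsCell R E) (p : E →ₗ[R] U) (hp : Function.Surjective p) (q : E →ₗ[R] U')
    (hq : Function.Surjective q) : Nonempty (U ≃ₗ[R] U') := by
  have heq := (hE.ker_le_ker q hq p hp).antisymm (hE.ker_le_ker p hp q hq)
  exact ⟨(p.quotKerEquivOfSurjective hp).symm ≪≫ₗ Submodule.quotEquivOfEq _ _ heq ≪≫ₗ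
    q.quotKerEquivOfSurjective hq⟩

variable {T T' : Type u} [AddCommGroup T] [Module R T] [AddCommGroup T'] [Module R T']

/-- Cells with isomorphic simple quotients have isomorphic simple submodules. -/
lemma IsCell.nonempty_equiv_sub [IsSimpleModule R U] [IsSimpleModule R T] [IsSimpleModule R T']
    (hE : IsCell R E) (hE' : IsCell R E') (p : E →ₗ[R] U) (hp : Function.Surjective p)
    (p' : E' →ₗ[R] U) (hp' : Function.Surjective p') (i : T →ₗ[R] E) (hi : Function.Injective i)
    (i' : T' →ₗ[R] E') (hi' : Function.Injective i') : Nonempty (T ≃ₗ[R] T') := by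
  have := hE.projective
  have := hE'.projective
  obtain ⟨g, hg⟩ := Module.projective_lifting_property p' p hp'
  obtain ⟨h, hh⟩ := Module.projective_lifting_property p p' hp
  -- `h ∘ g` is compatible with `p`, so `g` is injective; in the uniform `E'` the simples `g (i T)`
  -- and `i' T'` then meet, hence coincide.
  have hinj := hE.injective_of_comp_eq p hp (h ∘ₗ g) fun x =>
    (LinearMap.congr_fun hh (g x)).trans (LinearMap.congr_fun hg x)
  have hginj : Function.Injective g := Function.Injective.of_comp (f := h) hinj
  have := IsSimpleModule.nontrivial R T
  have := IsSimpleModule.nontrivial R T'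
  obtain ⟨t, ht⟩ := exists_ne (0 : T)
  obtain ⟨t', ht'⟩ := exists_ne (0 : T')
  have hgi : Function.Injective (g ∘ₗ i) := hginj.comp hi
  obtain ⟨r, s, e, hne⟩ := hE'.uniform (g (i t)) (i' t')
    (fun h0 => ht (hgi (h0.trans (map_zero (g ∘ₗ i)).symm)))
    (fun h0 => ht' (hi' (h0.trans (map_zero i').symm)))
  have hmem : ∀ x, g (i x) ∈ LinearMap.range i' := by
    have hrt : r • t ≠ 0 := fun h0 => hne (by rw [← map_smul, ← map_smul, h0]; simp)
    intro x
    obtain ⟨a, rfl⟩ := IsSimpleModule.toSpanSingleton_surjective R hrt x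
    refine ⟨a • s • t', ?_⟩
    simp only [LinearMap.toSpanSingleton_apply, map_smul] at *
    rw [e]
  let k : T →ₗ[R] T' := (LinearEquiv.ofInjective i' hi').symm.toLinearMap ∘ₗ
    (g ∘ₗ i).codRestrict (LinearMap.range i') hmem
  have hk : k ≠ 0 := fun h0 => ht (by
    have hkt : k t = 0 := LinearMap.congr_fun h0 t
    have h1 := (LinearEquiv.ofInjective i' hi').symm.map_eq_zero_iff.1 hkt
    exact hgi ((congrArg Subtype.val h1).trans (map_zero (g ∘ₗ i)).symm))
  exact ⟨LinearEquiv.ofBijective k (LinearMap.bijective_of_ne_zero hk)⟩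

/-- Cells with isomorphic simple submodules have isomorphic simple quotients. -/
lemma IsCell.nonempty_equiv_quot [IsSimpleModule R U] [IsSimpleModule R U'] [IsSimpleModule R T]
    (hE : IsCell R E) (hE' : IsCell R E') (p : E →ₗ[R] U) (hp : Function.Surjective p)
    (p' : E' →ₗ[R] U') (hp' : Function.Surjective p') (i : T →ₗ[R] E) (hi : Function.Injective i)
    (i' : T →ₗ[R] E') (hi' : Function.Injective i') : Nonempty (U ≃ₗ[R] U') := by
  have := nontrivial_of_surjective p hp
  have := IsSimpleModule.nontrivial R T
  obtain ⟨g, hg⟩ := hE'.injective.out i hi i'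
  have hginj : Function.Injective g := hE.uniform.injective_of_comp g i (by
    intro x y h
    simp only [LinearMap.comp_apply, hg] at h
    exact hi' h)
  have hgs := surjective_of_injective hE.injective hE'.uniform g hginj
  exact hE.nonempty_equiv_of_surjective p hp (p' ∘ₗ g) (hp'.comp hgs)

end Cells

/-! ### If injectives are projective, then projectives are injective. -/

/-- A relation on the simple submodules of a Noetherian module which is total on the left and
injective up to isomorphism is surjective up to isomorphism. -/
lemma exists_simple_of_rel {N : Type u} [AddCommGroup N] [Module R N] [IsNoetherian R N]
    (ρ : Submodule R N → Submodule R N → Prop)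
    (hex : ∀ S : Submodule R N, IsSimpleModule R S → ∃ T : Submodule R N,
      IsSimpleModule R T ∧ ρ S T)
    (hinj : ∀ S S' T T' : Submodule R N, IsSimpleModule R S → IsSimpleModule R S' →
      IsSimpleModule R T → IsSimpleModule R T' → ρ S T → ρ S' T' → Nonempty (T ≃ₗ[R] T') →
      Nonempty (S ≃ₗ[R] S')) (T : Submodule R N) (hT : IsSimpleModule R T) :
    ∃ S T' : Submodule R N, IsSimpleModule R S ∧ IsSimpleModule R T' ∧ ρ S T' ∧
      Nonempty (T' ≃ₗ[R] T) := by
  have hiso : ∀ S S' : Submodule R N, IsSimpleModule R S → IsSimpleModule R S' →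
      isotypicComponent R N S = isotypicComponent R N S' → Nonempty (S ≃ₗ[R] S') := by
    intro S S' _ _ e
    exact isIsotypicOfType_submodule_iff.1 (IsIsotypicOfType.isotypicComponent R N S') S
      (e ▸ S.le_isotypicComponent)
  choose s hs hcs using fun c : isotypicComponents R N => c.2
  choose t ht hρ using fun c => hex (s c) (hs c)
  let F : isotypicComponents R N → isotypicComponents R N := fun c =>
    ⟨isotypicComponent R N (t c), t c, ht c, rfl⟩
  have hF : Function.Injective F := by
    intro c d h
    obtain ⟨e⟩ := hinj _ _ _ _ (hs c) (hs d) (ht c) (ht d) (hρ c) (hρ d)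
      (hiso _ _ (ht c) (ht d) (congrArg Subtype.val h))
    exact Subtype.ext ((hcs c).trans (e.isotypicComponent_eq.trans (hcs d).symm))
  -- Isotypic components stand for isomorphism classes; a Noetherian module has finitely many.
  obtain ⟨c, hc⟩ := Finite.injective_iff_surjective.1 hF ⟨isotypicComponent R N T, T, hT, rfl⟩
  exact ⟨s c, t c, hs c, ht c, hρ c, hiso _ _ (ht c) hT (congrArg Subtype.val hc)⟩

/-- A map from a countable product to a direct sum of copies of `R` is, on deep enough elements
killed by a deep enough ideal of an ascending chain, concentrated in finitely many coordinates up
to elements killed by the whole chain. -/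
lemma exists_finset_of_chain (I : ℕ →o Ideal R) {P : Type v} [AddCommGroup P] [Module R P]
    {ι : Type w} (f : (ℕ → P) →ₗ[R] (ι →₀ R)) :
    ∃ (n : ℕ) (F : Finset ι), ∀ y : ℕ → P, (∀ k < n, y k = 0) → (∀ a ∈ I n, a • y = 0) →
      ∀ j ∉ F, ∀ m, ∀ a ∈ I m, a * f y j = 0 := by
  classical
  by_contra hcon
  push Not at hcon
  choose Y hY0 hYk J hJ m a ha hne using hcon
  -- The recursion takes a counterexample `y k`, `j k` at each stage, then raises `n` past its `m`
  -- and adds to `F` the support of `f (y k)` and the point `j k`.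
  let st : ℕ → ℕ × Finset ι := fun k => Nat.rec (0, ∅) (fun _ s =>
    (max (s.1 + 1) (m s.1 s.2), s.2 ∪ (f (Y s.1 s.2)).support ∪ {J s.1 s.2})) k
  let n := fun k => (st k).1
  let F := fun k => (st k).2
  let y := fun k => Y (n k) (F k)
  let j := fun k => J (n k) (F k)
  let b := fun k => a (n k) (F k)
  have hn : ∀ k, n (k + 1) = max (n k + 1) (m (n k) (F k)) := fun _ => rfl
  have hF : ∀ k, F (k + 1) = F k ∪ (f (y k)).support ∪ {j k} := fun _ => rfl
  have hnmono : StrictMono n := strictMono_nat_of_lt_succ fun k => by rw [hn]; omega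
  have hFmono : Monotone F := monotone_nat_of_le_succ fun k => by
    rw [hF, Finset.union_assoc]
    exact Finset.subset_union_left
  have hj : ∀ k, j k ∉ F k := fun k => hJ _ _
  -- `z k` is the infinite sum of the `y l`, `l ≥ k`: at coordinate `i` the terms with `l > i`
  -- vanish.
  let z : ℕ → ℕ → P := fun k i => ∑ l ∈ Finset.Ico k (i + 1), y l i
  have hz : ∀ k, z k = y k + z (k + 1) := by
    intro k
    funext i
    by_cases hki : k ≤ i
    · exact Finset.sum_eq_sum_Ico_succ_bot (Nat.lt_succ_of_le hki) _
    · have h1 : y k i = 0 := hY0 _ _ i (by have := hnmono.le_apply (x := k); omega)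
      have h2 : Finset.Ico k (i + 1) = ∅ := Finset.Ico_eq_empty (by omega)
      have h3 : Finset.Ico (k + 1) (i + 1) = ∅ := Finset.Ico_eq_empty (by omega)
      simp [z, h1, h2, h3]
  have hzk : ∀ k, ∀ c ∈ I (n k), c • z k = 0 := by
    intro k c hc
    funext i
    change c • ∑ l ∈ Finset.Ico k (i + 1), y l i = 0
    rw [Finset.smul_sum]
    refine Finset.sum_eq_zero fun l hl => ?_
    exact congrFun (hYk (n l) (F l) c
      (I.monotone (hnmono.monotone (Finset.mem_Ico.1 hl).1) hc)) i
  have hconst : ∀ k l, l ≤ k → f (z 0) (j k) = f (z l) (j k) := by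
    intro k l
    induction l with
    | zero => exact fun _ => rfl
    | succ l ih =>
      intro hl
      rw [ih (by omega), hz l, map_add, Finsupp.add_apply]
      have : f (y l) (j k) = 0 := by
        by_contra hne
        refine hj k (hFmono hl ?_)
        rw [hF]
        simp [hne]
      rw [this, zero_add]
  -- At `j k` the earlier terms contribute nothing, and `b k` kills the tail `z (k + 1)` but not `f
  -- (y k) (j k)`.
  have hmem : ∀ k, j k ∈ (f (z 0)).support := by
    intro k
    rw [Finsupp.mem_support_iff]
    intro h0
    refine hne (n k) (F k) ?_
    have h1 : f (y k) (j k) + f (z (k + 1)) (j k) = 0 := by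
      rw [← Finsupp.add_apply, ← map_add, ← hz, ← hconst k k le_rfl, h0]
    have h2 : b k * f (z (k + 1)) (j k) = 0 := by
      rw [← smul_eq_mul, ← Finsupp.smul_apply, ← map_smul,
        hzk (k + 1) (b k) (I.monotone (by rw [hn]; exact le_max_right _ _) (ha _ _)), map_zero,
        Finsupp.zero_apply]
    simpa [mul_add, h2] using congrArg (b k * ·) h1
  have hinj : Function.Injective j := by
    refine Function.Injective.of_lt_imp_ne fun l k hlk e => hj k (hFmono hlk ?_)
    rw [← e, hF]
    simp
  exact Set.infinite_of_injective_forall_mem hinj hmem (f (z 0)).support.finite_toSet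

/-- If every module embeds in a free module, the ring is left Noetherian. -/
lemma isNoetherianRing_of_embeds
    (h : ∀ (M : Type u) [AddCommGroup M] [Module R M], ∃ (ι : Type u) (f : M →ₗ[R] (ι →₀ R)),
      Function.Injective f) : IsNoetherianRing R := by
  rw [isNoetherianRing_iff, ← monotone_stabilizes_iff_noetherian]
  intro I
  let A := ∀ n, R ⧸ I n
  let κ := ℕ → R
  obtain ⟨ι, f, hf⟩ := h (ℕ → κ → A)
  obtain ⟨n, F, hF⟩ := exists_finset_of_chain I f
  refine ⟨n, fun m hnm => ?_⟩
  by_contra hne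
  obtain ⟨c, hcm, hcn⟩ := Set.exists_of_ssubset ((I.monotone hnm).lt_of_ne hne)
  classical
  let x : A := Pi.single n (Submodule.Quotient.mk 1)
  have hx : ∀ a : R, a • x = 0 ↔ a ∈ I n := by
    intro a
    rw [← Pi.single_smul, Pi.single_eq_zero_iff, ← Submodule.Quotient.mk_smul,
      Submodule.Quotient.mk_eq_zero, smul_eq_mul, mul_one]
  -- `x` has annihilator exactly `I n`, so `e T` meets the hypotheses of `hF`. As `c ∈ I m` does not
  -- kill `x`, the coordinates of `f (e T)` in `F` determine `T`.
  let e : Set κ → ℕ → κ → A := fun T => Pi.single n fun i => if i ∈ T then x else 0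
  refine not_injective_set_seq_to_finset F (fun T j => f (e T) j.1) fun T T' hTT' => ?_
  have hd0 : c • (e T - e T') = 0 := by
    apply hf
    rw [map_zero]
    ext j
    rw [map_smul, Finsupp.smul_apply, smul_eq_mul, Finsupp.zero_apply]
    by_cases hj : j ∈ F
    · have := congrFun hTT' ⟨j, hj⟩
      rw [map_sub, Finsupp.sub_apply, sub_eq_zero.2 this, mul_zero]
    · refine hF _ (fun k hk => ?_) (fun a ha => ?_) j hj m c hcm
      · simp [e, hk.ne]
      · rw [← Pi.single_sub, ← Pi.single_smul, Pi.single_eq_zero_iff]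
        funext i
        have := (hx a).2 ha
        by_cases hi : i ∈ T <;> by_cases hi' : i ∈ T' <;> simp [hi, hi', this]
  rw [← Pi.single_sub, ← Pi.single_smul, Pi.single_eq_zero_iff] at hd0
  have hcx : c • x ≠ 0 := fun h0 => hcn ((hx c).1 h0)
  ext i
  have := congrFun hd0 i
  by_cases hi : i ∈ T <;> by_cases hi' : i ∈ T' <;> simp [hi, hi', hcx] at this ⊢

/-- If all injective modules are projective, then every module embeds in a free module. -/
lemma embeds_of_injective_projective
    (H : ∀ (M : Type u) [AddCommGroup M] [Module R M], Module.Injective R M →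
      Module.Projective R M) (M : Type u) [AddCommGroup M] [Module R M] :
    ∃ (ι : Type u) (f : M →ₗ[R] (ι →₀ R)), Function.Injective f := by
  obtain ⟨E, _, _, hE, i, hi⟩ := exists_injective_embedding (R := R) M
  obtain ⟨s, hs⟩ := (H E hE).out
  exact ⟨E, s ∘ₗ i, hs.injective.comp hi⟩

/-- If all injective modules are projective, each simple module embeds in a cell that is a left
ideal. -/
lemma exists_cell_of_injective_projective
    (H : ∀ (M : Type u) [AddCommGroup M] [Module R M], Module.Injective R M →
      Module.Projective R M) (T : Type u) [AddCommGroup T] [Module R T] [IsSimpleModule R T] :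
    ∃ (E : Ideal R) (i : T →ₗ[R] E), IsCell R E ∧ Function.Injective i := by
  have hnoeth := isNoetherianRing_of_embeds (embeds_of_injective_projective H)
  have := IsSimpleModule.nontrivial R T
  obtain ⟨t, ht⟩ := exists_ne (0 : T)
  obtain ⟨M, _, _, hM, i, hi⟩ := exists_injective_embedding (R := R) T
  obtain ⟨E, K, hTE, hEK, hess⟩ := exists_essential_summand hM (LinearMap.range i)
  have hEinj := injective_of_isCompl hM hEK
  let k : T →ₗ[R] E := i.codRestrict E fun x => hTE ⟨x, rfl⟩
  have hk : Function.Injective k := fun x y h => hi (congrArg Subtype.val h)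
  have hess' : ∀ x : E, x ≠ 0 → ∃ (r : R) (t : T), t ≠ 0 ∧ r • x = k t := by
    intro x hx
    obtain ⟨r, ⟨t, ht⟩, hr⟩ := hess x x.2 (fun h => hx (Subtype.ext h))
    refine ⟨r, t, fun h0 => hr ?_, Subtype.ext ht.symm⟩
    rw [← ht, h0, map_zero]
  have huni : IsUniform R E := by
    intro x y hx hy
    obtain ⟨r, t, ht, hrt⟩ := hess' x hx
    obtain ⟨r', t', ht', hrt'⟩ := hess' y hy
    obtain ⟨c, hc⟩ := IsSimpleModule.toSpanSingleton_surjective R ht' t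
    rw [LinearMap.toSpanSingleton_apply] at hc
    refine ⟨r, c * r', ?_, ?_⟩
    · rw [hrt, mul_smul, hrt', ← map_smul, hc]
    · rw [hrt]
      exact fun h0 => ht (hk (h0.trans (map_zero k).symm))
  -- The projective `E` sits in a free module; a coordinate nonzero on `T` is injective on `E` by
  -- uniformity, making `E` a left ideal.
  obtain ⟨s, hs⟩ := (H E hEinj).out
  have hskt : s (k t) ≠ 0 := fun h0 => ht (hk (hs.injective (by simp [h0])))
  obtain ⟨j, hj⟩ := Finsupp.ne_iff.1 hskt
  let g : E →ₗ[R] R := Finsupp.lapply j ∘ₗ s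
  have hg : Function.Injective g := huni.injective_of_comp g k
    (LinearMap.injective_of_ne_zero fun h0 => hj (LinearMap.congr_fun h0 t))
  let φ : E ≃ₗ[R] LinearMap.range g := LinearEquiv.ofInjective g hg
  have huni' : IsUniform R (LinearMap.range g) := by
    intro x y hx hy
    obtain ⟨r, s, e, hne⟩ := huni (φ.symm x) (φ.symm y) (by simpa using hx) (by simpa using hy)
    rw [← map_smul, ← map_smul] at e
    rw [← map_smul] at hne
    exact ⟨r, s, φ.symm.injective e, fun h0 => hne (by rw [h0, map_zero])⟩
  have hinj' := injective_of_retract hEinj φ.symm.toLinearMap φ.toLinearMap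
    fun x => φ.apply_symm_apply x
  exact ⟨LinearMap.range g, φ.toLinearMap ∘ₗ k, ⟨hinj', H _ hinj', huni',
    fun f hf => huni'.isNilpotent_of_noetherian f hf⟩, φ.injective.comp hk⟩

/-- If every simple module is a quotient of an injective left ideal of the left Noetherian ring
`R`, then `R` is left self-injective. -/
lemma injective_self_of_simple_quotients [IsNoetherianRing R]
    (h : ∀ L : Ideal R, L.IsMaximal → ∃ (E : Ideal R) (p : E →ₗ[R] R ⧸ L),
      Module.Injective R E ∧ Function.Surjective p)
    (hproj : ∀ E : Ideal R, Module.Injective R E → Module.Projective R E) :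
    Module.Injective R R := by
  classical
  let ι := Σ E : {E : Ideal R // Module.Injective R E}, (E.1 →ₗ[R] R)
  let φ : (Π₀ i : ι, i.1.1) →ₗ[R] R := DFinsupp.lsum ℕ fun i => i.2
  -- A maximal `L` containing the range would contain `g x ≡ 1`, where `g` lifts a surjection onto
  -- `R ⧸ L`.
  have hφ : LinearMap.range φ = ⊤ := by
    by_contra hne
    obtain ⟨L, hL, hle⟩ := Ideal.exists_le_maximal _ hne
    obtain ⟨E, p, hE, hp⟩ := h L hL
    have := hproj E hE
    obtain ⟨g, hg⟩ := Module.projective_lifting_property L.mkQ p L.mkQ_surjective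
    obtain ⟨x, hx⟩ := hp (L.mkQ 1)
    have h1 : g x ∈ L := hle ⟨DFinsupp.single (⟨⟨E, hE⟩, g⟩ : ι) x, by simp [φ]⟩
    have h2 : L.mkQ (g x) = L.mkQ 1 := (LinearMap.congr_fun hg x).trans hx
    have h3 : L.mkQ (g x) = 0 := (Submodule.Quotient.mk_eq_zero L).2 h1
    have h4 : (1 : R) ∈ L := (Submodule.Quotient.mk_eq_zero L).1 (h2.symm.trans h3)
    exact hL.ne_top ((Ideal.eq_top_iff_one L).2 h4)
  obtain ⟨s, hs⟩ := LinearMap.exists_rightInverse_of_surjective φ hφ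
  exact injective_of_retract (injective_dfinsupp (fun i : ι => i.1.1) fun i => i.1.2) s φ
    fun x => LinearMap.congr_fun hs x

/-- If all injective modules are projective, then all projective modules are injective. -/
lemma projective_injective_of_injective_projective
    (H : ∀ (M : Type u) [AddCommGroup M] [Module R M], Module.Injective R M →
      Module.Projective R M) (P : Type u) [AddCommGroup P] [Module R P]
    (hP : Module.Projective R P) : Module.Injective R P := by
  have := isNoetherianRing_of_embeds (embeds_of_injective_projective H)
  refine injective_of_projective (injective_finsupp_of_noetherian
    (injective_self_of_simple_quotients (fun L hL => ?_) fun E hE => H E hE)) P hP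
  have hLs : IsSimpleModule R (R ⧸ L) := isSimpleModule_iff_isCoatom.2 (Ideal.isMaximal_def.1 hL)
  have hemb : ∀ (T : Type u) [AddCommGroup T] [Module R T] [IsSimpleModule R T],
      ∃ S : Ideal R, Nonempty (T ≃ₗ[R] S) := by
    intro T _ _ _
    obtain ⟨E, i, -, hi⟩ := exists_cell_of_injective_projective H T
    exact ⟨_, ⟨LinearEquiv.ofInjective (E.subtype ∘ₗ i) (Subtype.val_injective.comp hi)⟩⟩
  obtain ⟨T, ⟨eT⟩⟩ := hemb (R ⧸ L)
  have hT := IsSimpleModule.congr eT.symm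
  -- `S` is related to `U` when some cell has `S` as a submodule and `U` as a quotient.
  obtain ⟨S, T', hS, hT', ⟨E, i, p, hE, hi, hp⟩, ⟨e⟩⟩ := exists_simple_of_rel
    (fun S U : Ideal R => ∃ (E : Ideal R) (i : S →ₗ[R] E) (p : E →ₗ[R] U), IsCell R E ∧
      Function.Injective i ∧ Function.Surjective p)
    (fun S _ => by
      obtain ⟨E, i, hE, hi⟩ := exists_cell_of_injective_projective H S
      have := IsSimpleModule.nontrivial R S
      have : Nontrivial E := hi.nontrivial
      obtain ⟨M, hM, -⟩ := (IsCoatomic.eq_top_or_exists_le_coatom (⊥ : Submodule R E)).resolve_left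
        bot_ne_top
      have := isSimpleModule_iff_isCoatom.2 hM
      obtain ⟨U, ⟨e⟩⟩ := hemb (E ⧸ M)
      exact ⟨U, IsSimpleModule.congr e.symm, E, i, e.toLinearMap ∘ₗ M.mkQ, hE, hi,
        e.surjective.comp M.mkQ_surjective⟩)
    (by
      rintro S S' U U' _ _ _ _ ⟨E, i, p, hE, hi, hp⟩ ⟨E', i', p', hE', hi', hp'⟩ ⟨e⟩
      exact hE.nonempty_equiv_sub hE' (e.toLinearMap ∘ₗ p) (e.surjective.comp hp) p' hp' i hi i'
        hi') T hT
  exact ⟨E, eT.symm.toLinearMap ∘ₗ e.toLinearMap ∘ₗ p, hE.injective,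
    eT.symm.surjective.comp (e.surjective.comp hp)⟩

/-! ### If free modules are injective, the ring is semiprimary. -/

/-- The left annihilator of a set. -/
def lAnn (X : Set R) : Ideal R where
  carrier := {a | ∀ x ∈ X, a * x = 0}
  add_mem' ha hb x hx := by rw [add_mul, ha x hx, hb x hx, add_zero]
  zero_mem' x _ := zero_mul x
  smul_mem' c a ha x hx := by rw [smul_eq_mul, mul_assoc, ha x hx, mul_zero]

lemma mem_lAnn {X : Set R} {a : R} : a ∈ lAnn X ↔ ∀ x ∈ X, a * x = 0 := Iff.rfl

lemma lAnn_anti {X Y : Set R} (h : X ⊆ Y) : lAnn Y ≤ lAnn X := fun _ ha x hx => ha x (h hx)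

/-- If the free module of countable rank is injective, ascending chains of left annihilators
stabilize. -/
lemma lAnn_stabilizes (hI : Module.Injective R (ULift.{u} ℕ →₀ R)) (X : ℕ → Set R)
    (hX : Antitone X) : ∃ n, ∀ m, lAnn (X m) ≤ lAnn (X n) := by
  let I : Ideal R := ⨆ n, lAnn (X n)
  have hmono : Monotone fun n => lAnn (X n) := fun m n h => lAnn_anti (hX h)
  have hmem : ∀ a ∈ I, ∃ n, a ∈ lAnn (X n) := fun a ha =>
    (Submodule.mem_iSup_of_directed _ hmono.directed_le).1 ha
  by_contra hcon
  push Not at hcon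
  have hx : ∀ n, ∃ x ∈ X n, ∃ a ∈ I, a * x ≠ 0 := by
    intro n
    by_contra h
    push Not at h
    obtain ⟨m, hm⟩ := hcon n
    exact hm fun a ha x hx => h x hx a (le_iSup (fun n => lAnn (X n)) m ha)
  choose x hxX a ha hax using hx
  -- The map `b ↦ (b * x i)` extends to `R`, so it is `b ↦ b • g' 1`, with fixed finite support,
  -- although each `x i` survives some element of `I`.
  have hfin : ∀ b : I, (Function.support fun i : ULift.{u} ℕ => b.1 * x i.down).Finite := by
    intro b
    obtain ⟨n, hn⟩ := hmem b b.2
    refine ((Set.finite_lt_nat n).preimage ULift.down_injective.injOn).subset fun i hi => ?_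
    by_contra hlt
    exact hi (hn _ (hX (not_lt.1 hlt) (hxX _)))
  let g : I →ₗ[R] (ULift.{u} ℕ →₀ R) :=
    { toFun := fun b => Finsupp.ofSupportFinite _ (hfin b)
      map_add' := fun b c => Finsupp.ext fun i => add_mul b.1 c.1 _
      map_smul' := fun r b => Finsupp.ext fun i => mul_assoc r b.1 _ }
  obtain ⟨g', hg'⟩ := Module.Baer.of_injective hI I g
  obtain ⟨i, hi⟩ := Infinite.exists_notMem_finset (g' 1).support
  refine hax i.down ?_
  have h1 : g' (a i.down) i = a i.down * x i.down := by
    rw [hg' _ (ha i.down)]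
    rfl
  have h2 : g' (a i.down) = a i.down • g' 1 := by rw [← map_smul, smul_eq_mul, mul_one]
  rw [← h1, h2, Finsupp.smul_apply, Finsupp.notMem_support_iff.1 hi, smul_zero]

/-- Over a left self-injective ring, finitely generated right ideals are right annihilators. -/
lemma exists_sum_mul_eq (hR : Module.Injective R R) {ι : Type*} [Fintype ι] (b : ι → R) (a : R)
    (h : ∀ s : R, (∀ i, s * b i = 0) → s * a = 0) : ∃ c : ι → R, a = ∑ i, b i * c i := by
  classical
  let φ : R →ₗ[R] (ι → R) := LinearMap.toSpanSingleton R _ b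
  -- The map `s • b ↦ s * a` on the submodule generated by `b` is well defined; the `c i` are the
  -- values of an extension on the unit vectors.
  obtain ⟨i, hi⟩ := exists_factor φ.rangeRestrict φ.surjective_rangeRestrict
    (LinearMap.toSpanSingleton R R a) fun s t e => by
      have e' : s • b = t • b := congrArg Subtype.val e
      have := h (s - t) fun i => by
        rw [sub_mul, sub_eq_zero]
        exact congrFun e' i
      rw [sub_mul, sub_eq_zero] at this
      exact this
  obtain ⟨k, hk⟩ := Module.Injective.extension_property R R _ _ (LinearMap.range φ).subtype
    Subtype.val_injective i
  refine ⟨fun j => k (Pi.single j 1), ?_⟩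
  have h1 : k b = a := by
    have h2 := LinearMap.congr_fun hk (φ.rangeRestrict 1)
    rw [hi] at h2
    simpa [φ] using h2
  rw [← h1, LinearMap.pi_apply_eq_sum_univ k b]
  refine Finset.sum_congr rfl fun i _ => ?_
  rw [smul_eq_mul]
  congr 2
  funext j
  simp [Pi.single_apply, eq_comm]

lemma exists_mul_eq (hR : Module.Injective R R) (b a : R) (h : ∀ s : R, s * b = 0 → s * a = 0) :
    ∃ c, a = b * c := by
  obtain ⟨c, hc⟩ := exists_sum_mul_eq hR (fun _ : Unit => b) a fun s hs => h s (hs ())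
  exact ⟨c (), by simpa using hc⟩

lemma injective_self_of_finsupp (hI : ∀ ι : Type u, Module.Injective R (ι →₀ R)) :
    Module.Injective R R :=
  injective_of_retract (hI PUnit) (Finsupp.lsingle PUnit.unit) (Finsupp.lapply PUnit.unit)
    fun x => by simp

/-- Descending chains of principal right ideals stabilize. -/
lemma principal_right_ideals_stabilize (hI : ∀ ι : Type u, Module.Injective R (ι →₀ R))
    (a : ℕ → R) (ha : ∀ n, ∃ c, a (n + 1) = a n * c) :
    ∃ n, ∃ c, a n = a (n + 1) * c := by
  obtain ⟨n, hn⟩ := lAnn_stabilizes (hI _) (fun n => {x | ∃ c, x = a n * c})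
    (antitone_nat_of_succ_le fun n => by
      rintro _ ⟨c, rfl⟩
      obtain ⟨d, hd⟩ := ha n
      exact ⟨d * c, by rw [hd, mul_assoc]⟩)
  refine ⟨n, exists_mul_eq (injective_self_of_finsupp hI) _ _ fun s hs => ?_⟩
  refine hn (n + 1) ?_ (a n) ⟨1, (mul_one _).symm⟩
  rintro _ ⟨c, rfl⟩
  rw [← mul_assoc, hs, zero_mul]

/-- Each maximal left ideal misses an idempotent `e` with `eR` minimal. -/
lemma exists_minimal_idempotent (hI : ∀ ι : Type u, Module.Injective R (ι →₀ R))
    (L : Ideal R) (hL : L.IsMaximal) :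
    ∃ e : R, e * e = e ∧ e ∉ L ∧ ∀ f : R, f * f = f → e * f = f → f ∉ L → f * e = e := by
  let r : R → R → Prop := fun a b => (∃ c, a = b * c) ∧ ¬ ∃ c, b = a * c
  have : IsStrictOrder R r :=
    { irrefl := fun a h => h.2 h.1
      trans := fun a b c ⟨⟨x, hx⟩, h⟩ ⟨⟨y, hy⟩, _⟩ => ⟨⟨y * x, by rw [hx, hy, mul_assoc]⟩,
        fun ⟨z, hz⟩ => h ⟨z * y, by rw [← mul_assoc, ← hz, hy]⟩⟩ }
  have hwf : WellFounded r := by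
    rw [RelEmbedding.wellFounded_iff_isEmpty]
    refine ⟨fun f => ?_⟩
    have hf : ∀ n, r (f (n + 1)) (f n) := fun n => f.map_rel_iff.2 (Nat.lt_succ_self n)
    obtain ⟨n, hn⟩ := principal_right_ideals_stabilize hI f fun n => (hf n).1
    exact (hf n).2 hn
  obtain ⟨e, ⟨he, heL⟩, hmin⟩ := hwf.has_min {e : R | e * e = e ∧ e ∉ L}
    ⟨1, mul_one 1, fun h => hL.ne_top ((Ideal.eq_top_iff_one L).2 h)⟩
  refine ⟨e, he, heL, fun f hf hef hfL => ?_⟩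
  by_contra hne
  refine hmin f ⟨hf, hfL⟩ ⟨⟨f, hef.symm⟩, fun ⟨c, hc⟩ => hne ?_⟩
  rw [hc, ← mul_assoc, hf]

/-- Each maximal left ideal misses a left ideal that is a cell. -/
lemma exists_cell_not_le (hI : ∀ ι : Type u, Module.Injective R (ι →₀ R))
    (L : Ideal R) (hL : L.IsMaximal) : ∃ E : Ideal R, IsCell R E ∧ ¬ E ≤ L := by
  obtain ⟨e, he, heL, hmin⟩ := exists_minimal_idempotent hI L hL
  have hR := injective_self_of_finsupp hI
  let E : Ideal R := Ideal.span {e}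
  have heE : e ∈ E := Ideal.mem_span_singleton_self e
  have hE : ∀ x ∈ E, x * e = x := by
    intro x hx
    obtain ⟨c, rfl⟩ := Ideal.mem_span_singleton'.1 hx
    rw [mul_assoc, he]
  let π : R →ₗ[R] E := LinearMap.toSpanSingleton R E ⟨e, heE⟩
  have hπ : ∀ x : E, π x = x := fun x => Subtype.ext (hE x x.2)
  have hEinj : Module.Injective R E := injective_of_retract hR E.subtype π hπ
  have hEproj : Module.Projective R E :=
    Module.Projective.of_split E.subtype π (LinearMap.ext hπ)
  -- A decomposition splits `e` into orthogonal idempotents; one lies outside `L` and equals `e` by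
  -- minimality.
  have hdec : ∀ A B : Submodule R E, IsCompl A B → A = ⊥ ∨ B = ⊥ := by
    intro A B hAB
    obtain ⟨a, ha, b, hb, hab⟩ := Submodule.mem_sup.1
      (hAB.sup_eq_top ▸ Submodule.mem_top : (⟨e, heE⟩ : E) ∈ A ⊔ B)
    have hab' : a.1 + b.1 = e := congrArg Subtype.val hab
    have key : ∀ x : E, x = x.1 • a + x.1 • b := fun x => by
      rw [← smul_add, hab]
      exact (hπ x).symm
    have hdisj := Submodule.disjoint_def.1 hAB.disjoint
    have hba : b.1 • a = 0 := by
      refine hdisj _ (A.smul_mem _ ha) ?_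
      have h1 : b.1 • a = b - b.1 • b := eq_sub_of_add_eq (key b).symm
      exact h1 ▸ sub_mem hb (B.smul_mem _ hb)
    have hab0 : a.1 • b = 0 := by
      refine hdisj _ ?_ (B.smul_mem _ hb)
      have h1 : a.1 • b = a - a.1 • a := eq_sub_of_add_eq' (key a).symm
      exact h1 ▸ sub_mem ha (A.smul_mem _ ha)
    have haa : a.1 * a.1 = a.1 := by
      have := key a
      rw [hab0, add_zero] at this
      exact (congrArg Subtype.val this).symm
    have hbb : b.1 * b.1 = b.1 := by
      have := key b
      rw [hba, zero_add] at this
      exact (congrArg Subtype.val this).symm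
    have hba' : b.1 * a.1 = 0 := congrArg Subtype.val hba
    have hab0' : a.1 * b.1 = 0 := congrArg Subtype.val hab0
    by_cases haL : a.1 ∈ L
    · left
      have hbL : b.1 ∉ L := fun hbL => heL (hab' ▸ add_mem haL hbL)
      have h1 := hmin b.1 hbb (by rw [← hab', add_mul, hbb, hab0', zero_add]) hbL
      rw [hE _ b.2] at h1
      have ha0 : a = 0 := Subtype.ext (by simpa [h1] using hab')
      rw [eq_bot_iff]
      intro x hx
      refine hdisj x hx ?_
      rw [key x, ha0, smul_zero, zero_add]
      exact B.smul_mem _ hb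
    · right
      have h1 := hmin a.1 haa (by rw [← hab', add_mul, haa, hba', add_zero]) haL
      rw [hE _ a.2] at h1
      have hb0 : b = 0 := Subtype.ext (by simpa [h1] using hab')
      rw [eq_bot_iff]
      intro x hx
      refine hdisj x ?_ hx
      rw [key x, hb0, smul_zero, add_zero]
      exact A.smul_mem _ ha
  have huni : IsUniform R E := by
    intro x y hx hy
    obtain ⟨N, K, hxN, hNK, hess⟩ := exists_essential_summand hEinj (Submodule.span R {x})
    have hK : K = ⊥ := (hdec N K hNK).resolve_left fun h0 =>
      hx (by simpa [h0] using hxN (Submodule.mem_span_singleton_self x))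
    have hN : N = ⊤ := by simpa [hK] using hNK.sup_eq_top
    obtain ⟨s, hs, hs0⟩ := hess y (hN ▸ Submodule.mem_top) hy
    obtain ⟨r, hr⟩ := Submodule.mem_span_singleton.1 hs
    exact ⟨r, s, hr, hr ▸ hs0⟩
  refine ⟨E, ⟨hEinj, hEproj, huni, fun f hf => ?_⟩, fun hle => heL (hle heE)⟩
  let a : R := f ⟨e, heE⟩
  have hfa : ∀ x : E, (f x).1 = x.1 * a := by
    intro x
    have h1 : f x = x.1 • f ⟨e, heE⟩ := by
      rw [← map_smul]
      exact congrArg f (hπ x).symm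
    rw [h1]
    rfl
  have hpow : ∀ n, ∀ x : E, ((f ^ n) x).1 = x.1 * a ^ n := by
    intro n
    induction n with
    | zero => simp
    | succ n ih => intro x; rw [pow_succ', Module.End.mul_apply, hfa, ih, pow_succ, mul_assoc]
  -- `f` is right multiplication by `a`, so stable annihilators mean stable kernels of its powers;
  -- the shift `k + 1` keeps the exponent nonzero.
  obtain ⟨n, hn⟩ := lAnn_stabilizes (hI _) (fun k => {x | ∃ c, x = a ^ (k + 1) * c})
    (antitone_nat_of_succ_le fun k => by
      rintro _ ⟨c, rfl⟩
      exact ⟨a * c, by rw [pow_succ _ (k + 1), mul_assoc]⟩)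
  refine huni.isNilpotent f hf (n + 1) n.succ_ne_zero fun x hx => Subtype.ext ?_
  rw [hpow]
  refine hn (n + 1 + n) ?_ _ ⟨1, (mul_one _).symm⟩
  rintro _ ⟨c, rfl⟩
  have h2 := congrArg Subtype.val hx
  rw [hpow, hpow, mul_assoc, ← pow_add] at h2
  rw [add_assoc, ← mul_assoc, h2]
  exact zero_mul c

/-- For a cell `E` not inside the maximal `L`, `E ∩ L` lies in every maximal left ideal by
`ker_le_ker`, so `E` has simple image in `R/J`. Hence no maximal submodule contains all simples. -/
lemma isSemisimpleModule_quotient_jacobson (hI : ∀ ι : Type u, Module.Injective R (ι →₀ R)) :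
    IsSemisimpleModule R (R ⧸ Ring.jacobson R) := by
  let J := Ring.jacobson R
  refine .of_sSup_simples_eq_top ?_
  by_contra hne
  obtain ⟨m, hm, hle⟩ := (IsCoatomic.eq_top_or_exists_le_coatom _).resolve_left hne
  let L : Ideal R := m.comap J.mkQ
  have hLcoatom : IsCoatom L := by
    have := isSimpleModule_iff_isCoatom.2 hm
    have h1 : L = LinearMap.ker (m.mkQ ∘ₗ J.mkQ) := by
      rw [LinearMap.ker_comp, Submodule.ker_mkQ]
    rw [h1]
    exact LinearMap.isCoatom_ker_of_surjective (m.mkQ_surjective.comp J.mkQ_surjective)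
  have hL : L.IsMaximal := ⟨hLcoatom⟩
  obtain ⟨E, hE, hEL⟩ := exists_cell_not_le hI L hL
  have hsimple : ∀ L : Ideal R, L.IsMaximal → IsSimpleModule R (R ⧸ L) := fun L hL =>
    isSimpleModule_iff_isCoatom.2 (Ideal.isMaximal_def.1 hL)
  have hsurj : ∀ L : Ideal R, L.IsMaximal → ¬ E ≤ L →
      Function.Surjective (L.mkQ ∘ₗ E.subtype) := by
    intro L hL h
    have := hsimple L hL
    refine LinearMap.surjective_of_ne_zero fun h0 => h fun x hx => ?_
    exact (Submodule.Quotient.mk_eq_zero L).1 (LinearMap.congr_fun h0 ⟨x, hx⟩)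
  have hEJ : ∀ x ∈ E, x ∈ L → x ∈ J := by
    intro x hxE hxL
    change x ∈ Ring.jacobson R
    rw [Ring.jacobson_eq_sInf_isMaximal, Submodule.mem_sInf]
    intro L' hL'
    by_cases hEL' : E ≤ L'
    · exact hEL' hxE
    have := hsimple L hL
    have := hsimple L' hL'
    have h1 := hE.ker_le_ker _ (hsurj L' hL' hEL') _ (hsurj L hL hEL)
    have h2 : (⟨x, hxE⟩ : E) ∈ LinearMap.ker (L.mkQ ∘ₗ E.subtype) :=
      (Submodule.Quotient.mk_eq_zero L).2 hxL
    exact (Submodule.Quotient.mk_eq_zero L').1 (h1 h2)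
  let φ : E →ₗ[R] R ⧸ J := J.mkQ ∘ₗ E.subtype
  have hφsimple : IsSimpleModule R (LinearMap.range φ) := by
    have := hsimple L hL
    have hker : LinearMap.ker φ = LinearMap.ker (L.mkQ ∘ₗ E.subtype) := by
      ext x
      change J.mkQ x.1 = 0 ↔ L.mkQ x.1 = 0
      rw [Submodule.mkQ_apply, Submodule.mkQ_apply, Submodule.Quotient.mk_eq_zero,
        Submodule.Quotient.mk_eq_zero]
      exact ⟨fun h => Ring.jacobson_le_of_isMaximal L h, hEJ x x.2⟩
    exact IsSimpleModule.congr (φ.quotKerEquivRange.symm ≪≫ₗ Submodule.quotEquivOfEq _ _ hker ≪≫ₗ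
      (L.mkQ ∘ₗ E.subtype).quotKerEquivOfSurjective (hsurj L hL hEL))
  refine hEL fun x hx => ?_
  exact hle (le_sSup (a := LinearMap.range φ) hφsimple ⟨⟨x, hx⟩, rfl⟩)

/-- A left inverse `z` of `1 - j` is `1 + z * j`, so it too has a left inverse. -/
lemma exists_mul_one_sub_eq_one {j : R} (hj : j ∈ Ring.jacobson R) : ∃ z, (1 - j) * z = 1 := by
  have hleft : ∀ j ∈ Ring.jacobson R, ∃ z, z * (1 - j) = 1 := by
    intro j hj
    by_contra h
    have hne : Ideal.span {1 - j} ≠ ⊤ := fun htop =>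
      h (Ideal.mem_span_singleton'.1 ((Ideal.eq_top_iff_one _).1 htop))
    obtain ⟨L, hL, hle⟩ := Ideal.exists_le_maximal _ hne
    refine hL.ne_top ((Ideal.eq_top_iff_one L).2 ?_)
    have h1 := add_mem (hle (Ideal.mem_span_singleton_self _)) (Ring.jacobson_le_of_isMaximal L hj)
    rwa [sub_add_cancel] at h1
  obtain ⟨z, hz⟩ := hleft j hj
  obtain ⟨w, hw⟩ := hleft (-(z * j)) (neg_mem (Ideal.mul_mem_left _ z hj))
  have h1 : 1 - -(z * j) = z := by
    rw [mul_sub, mul_one] at hz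
    rw [sub_neg_eq_add, ← hz]
    abel
  rw [h1] at hw
  exact ⟨z, left_inv_eq_right_inv hw hz ▸ hw⟩

/-- Once the annihilators of `J ^ n` stabilize, a nonzero `J ^ n` yields endless products of
elements of `J` outside `lAnn (J ^ n)`. Their principal right ideals stabilize, giving `a = a * y *
c` with `y * c ∈ J`, whence `a = 0`. -/
lemma isNilpotent_jacobson (hI : ∀ ι : Type u, Module.Injective R (ι →₀ R)) :
    IsNilpotent (Ring.jacobson R) := by
  let J := Ring.jacobson R
  obtain ⟨n, hn⟩ := lAnn_stabilizes (hI _) (fun n => ((J ^ n : Ideal R) : Set R))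
    fun m n h => Ideal.pow_le_pow_right h
  refine ⟨n, ?_⟩
  by_contra hne
  have h1 : (1 : R) ∉ lAnn ((J ^ n : Ideal R) : Set R) := fun h =>
    hne (eq_bot_iff.2 fun x hx => by simpa using h x hx)
  have hstep : ∀ x : {x : R // x ∉ lAnn ((J ^ n : Ideal R) : Set R)}, ∃ y ∈ J,
      x.1 * y ∉ lAnn ((J ^ n : Ideal R) : Set R) := by
    rintro ⟨x, hx⟩
    by_contra hcon
    push Not at hcon
    refine hx (hn (n + 1) fun z hz => ?_)
    rw [SetLike.mem_coe, Ideal.IsTwoSided.pow_succ, ← smul_eq_mul] at hz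
    refine Submodule.smul_induction_on hz (fun r hr s hs => ?_) fun s t hs ht => ?_
    · rw [smul_eq_mul, ← mul_assoc]
      exact hcon r hr s hs
    · rw [mul_add, hs, ht, add_zero]
  choose y hyJ hy using hstep
  let a : ℕ → {x : R // x ∉ lAnn ((J ^ n : Ideal R) : Set R)} := fun k =>
    Nat.rec ⟨1, h1⟩ (fun _ x => ⟨x.1 * y x, hy x⟩) k
  have ha : ∀ k, (a (k + 1)).1 = (a k).1 * y (a k) := fun _ => rfl
  obtain ⟨k, c, hc⟩ := principal_right_ideals_stabilize hI (fun k => (a k).1) fun k => ⟨_, ha k⟩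
  simp only [ha] at hc
  obtain ⟨z, hz⟩ := exists_mul_one_sub_eq_one (Ideal.mul_mem_right c J (hyJ (a k)))
  have h0 : (a k).1 = 0 := by
    have h2 : (a k).1 * (1 - y (a k) * c) = 0 := by
      rw [mul_sub, mul_one, ← mul_assoc, ← hc, sub_self]
    rw [← mul_one (a k).1, ← hz, ← mul_assoc, h2, zero_mul]
  exact (a k).2 (h0 ▸ zero_mem _)

lemma isSemiprimaryRing_of_free_injective (hI : ∀ ι : Type u, Module.Injective R (ι →₀ R)) :
    IsSemiprimaryRing R where
  isSemisimpleRing := by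
    have := isSemisimpleModule_quotient_jacobson hI
    let f : (R ⧸ Ring.jacobson R) →ₛₗ[Ideal.Quotient.mk (Ring.jacobson R)]
        (R ⧸ Ring.jacobson R) :=
      { toFun := id, map_add' := fun _ _ => rfl, map_smul' := fun r x => by
          obtain ⟨x, rfl⟩ := Ideal.Quotient.mk_surjective x
          rfl }
    exact (f.isSemisimpleModule_iff_of_bijective Function.bijective_id).1 this
  isNilpotent := isNilpotent_jacobson hI

lemma exists_simple_submodule_of_semiprimary [IsSemiprimaryRing R] (M : Type u) [AddCommGroup M]
    [Module R M] : Nontrivial M → ∃ S : Submodule R M, IsSimpleModule R S := by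
  refine IsSemiprimaryRing.induction R R M
    (P := fun M => Nontrivial M → ∃ S : Submodule R M, IsSimpleModule R S)
    (fun M _ _ _ _ _ _ _ => IsSemisimpleModule.exists_simple_submodule R M)
    fun M _ _ _ _ hN hq hM => ?_
  let N := Ring.jacobson R • (⊤ : Submodule R M)
  obtain h | h := subsingleton_or_nontrivial N
  · have hbot : N = ⊥ := Submodule.subsingleton_iff_eq_bot.1 h
    let e : (M ⧸ N) ≃ₗ[R] M := Submodule.quotEquivOfEqBot N hbot
    obtain ⟨S, hS⟩ := hq e.toEquiv.nontrivial
    exact ⟨S.map e.toLinearMap, IsSimpleModule.congr (e.submoduleMap S).symm⟩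
  · obtain ⟨S, hS⟩ := hN h
    exact ⟨S.map N.subtype,
      IsSimpleModule.congr (S.equivMapOfInjective _ N.subtype_injective).symm⟩

/-- If all free modules are injective, every simple module embeds in the ring. -/
lemma exists_simple_embedding (hI : ∀ ι : Type u, Module.Injective R (ι →₀ R)) (T : Type u)
    [AddCommGroup T] [Module R T] [IsSimpleModule R T] :
    ∃ f : T →ₗ[R] R, Function.Injective f := by
  have hsp := isSemiprimaryRing_of_free_injective hI
  have hss := isSemisimpleModule_quotient_jacobson hI
  let N := R ⧸ Ring.jacobson R
  have hmax : ∀ (T : Type u) [AddCommGroup T] [Module R T] [IsSimpleModule R T],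
      ∃ L : Ideal R, L.IsMaximal ∧ Nonempty (T ≃ₗ[R] R ⧸ L) := by
    intro T _ _ hT
    exact isSimpleModule_iff_quot_maximal.1 hT
  have hemb : ∀ (T : Type u) [AddCommGroup T] [Module R T] [IsSimpleModule R T],
      ∃ S : Submodule R N, Nonempty (T ≃ₗ[R] S) := by
    intro T _ _ _
    obtain ⟨L, hL, ⟨e⟩⟩ := hmax T
    let q : N →ₗ[R] R ⧸ L := Submodule.factor (Ring.jacobson_le_of_isMaximal L)
    obtain ⟨h, hh⟩ := IsSemisimpleModule.lifting_property q
      (Submodule.factor_surjective _) e.toLinearMap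
    have hinj : Function.Injective h := by
      refine Function.Injective.of_comp (f := q) ?_
      rw [← LinearMap.coe_comp, hh]
      exact e.injective
    exact ⟨_, ⟨LinearEquiv.ofInjective h hinj⟩⟩
  obtain ⟨T₀, ⟨eT⟩⟩ := hemb T
  have hT₀ := IsSimpleModule.congr eT.symm
  -- Here the pairing runs from the simple quotient of a cell to its simple submodule; surjectivity
  -- puts `T` inside a left ideal.
  obtain ⟨S, T', hS, hT', ⟨E, i, p, hE, hi, hp⟩, ⟨e⟩⟩ := exists_simple_of_rel
    (fun U S : Submodule R N => ∃ (E : Ideal R) (i : S →ₗ[R] E) (p : E →ₗ[R] U), IsCell R E ∧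
      Function.Injective i ∧ Function.Surjective p)
    (fun U _ => by
      obtain ⟨L, hL, ⟨e⟩⟩ := hmax U
      have hLs := IsSimpleModule.congr e.symm
      obtain ⟨E, hE, hEL⟩ := exists_cell_not_le hI L hL
      have hp : Function.Surjective (L.mkQ ∘ₗ E.subtype) :=
        LinearMap.surjective_of_ne_zero fun h0 => hEL fun x hx =>
          (Submodule.Quotient.mk_eq_zero L).1 (LinearMap.congr_fun h0 ⟨x, hx⟩)
      obtain ⟨m, hm⟩ := exists_simple_submodule_of_semiprimary (R := R) E
        (nontrivial_of_surjective _ hp)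
      obtain ⟨S, ⟨e'⟩⟩ := hemb m
      exact ⟨S, IsSimpleModule.congr e'.symm, E, m.subtype ∘ₗ e'.symm.toLinearMap,
        e.symm.toLinearMap ∘ₗ L.mkQ ∘ₗ E.subtype, hE,
        Subtype.val_injective.comp e'.symm.injective, e.symm.surjective.comp hp⟩)
    (by
      rintro U U' S S' _ _ _ _ ⟨E, i, p, hE, hi, hp⟩ ⟨E', i', p', hE', hi', hp'⟩ ⟨e⟩
      exact hE.nonempty_equiv_quot hE' p hp p' hp' i hi (i' ∘ₗ e.toLinearMap)
        (hi'.comp e.injective)) T₀ hT₀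
  exact ⟨E.subtype ∘ₗ i ∘ₗ e.symm.toLinearMap ∘ₗ eT.toLinearMap,
    Subtype.val_injective.comp (hi.comp (e.symm.injective.comp eT.injective))⟩

/-! ### Annihilator duality and the quasi-Frobenius property. -/

open MulOpposite

/-- A left self-injective ring in which all simple left modules embed is a cogenerator. -/
lemma exists_map_ne_zero (hR : Module.Injective R R)
    (hK : ∀ L : Ideal R, L.IsMaximal → ∃ f : (R ⧸ L) →ₗ[R] R, Function.Injective f)
    {M : Type u} [AddCommGroup M] [Module R M] (m : M) (hm : m ≠ 0) :
    ∃ g : M →ₗ[R] R, g m ≠ 0 := by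
  let φ : R →ₗ[R] M := LinearMap.toSpanSingleton R M m
  have hφ1 : φ 1 = m := one_smul R m
  have hne : LinearMap.ker φ ≠ ⊤ := fun h => hm (by
    rw [← hφ1]
    exact (h ▸ Submodule.mem_top : (1 : R) ∈ LinearMap.ker φ))
  obtain ⟨L, hL, hle⟩ := Ideal.exists_le_maximal _ hne
  obtain ⟨f, hf⟩ := hK L hL
  obtain ⟨i, hi⟩ := exists_factor φ.rangeRestrict φ.surjective_rangeRestrict
    (f ∘ₗ L.mkQ) fun s t e => by
      have e' : φ s = φ t := congrArg Subtype.val e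
      have h1 : s - t ∈ L := hle (by rw [LinearMap.mem_ker, map_sub, e', sub_self])
      exact congrArg f ((Submodule.Quotient.eq L).2 h1)
  obtain ⟨g, hg⟩ := hR.out (LinearMap.range φ).subtype Subtype.val_injective i
  refine ⟨g, fun h0 => hL.ne_top ((Ideal.eq_top_iff_one L).2 ?_)⟩
  have h1 := hg (φ.rangeRestrict 1)
  rw [hi, Submodule.subtype_apply, LinearMap.codRestrict_apply, hφ1, h0] at h1
  exact (Submodule.Quotient.mk_eq_zero L).1 (hf (h1.symm.trans (map_zero f).symm))

/-- As `R` is a cogenerator, every left ideal is the left annihilator of its right annihilator. -/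
lemma isNoetherianRing_of_free_injective (hI : ∀ ι : Type u, Module.Injective R (ι →₀ R))
    (hK : ∀ L : Ideal R, L.IsMaximal → ∃ f : (R ⧸ L) →ₗ[R] R, Function.Injective f) :
    IsNoetherianRing R := by
  rw [isNoetherianRing_iff, ← monotone_stabilizes_iff_noetherian]
  intro I
  let X : ℕ → Set R := fun n => {c | ∀ a ∈ I n, a * c = 0}
  have hX : ∀ n, lAnn (X n) = I n := by
    intro n
    refine le_antisymm (fun a ha => ?_) fun a ha x hx => hx a ha
    by_contra hna
    obtain ⟨g, hg⟩ := exists_map_ne_zero (injective_self_of_finsupp hI) hK ((I n).mkQ a)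
      fun h => hna ((Submodule.Quotient.mk_eq_zero _).1 h)
    have hgm : ∀ b : R, g ((I n).mkQ b) = b * g ((I n).mkQ 1) := fun b => by
      rw [← smul_eq_mul, ← map_smul, ← map_smul, smul_eq_mul, mul_one]
    refine hg ?_
    rw [hgm]
    refine ha _ fun b hb => ?_
    rw [← hgm, Submodule.mkQ_apply, (Submodule.Quotient.mk_eq_zero _).2 hb, map_zero]
  obtain ⟨n, hn⟩ := lAnn_stabilizes (hI _) X fun m n h c hc a ha => hc a (I.monotone h ha)
  refine ⟨n, fun m hm => (I.monotone hm).antisymm ?_⟩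
  rw [← hX m, ← hX n]
  exact hn m

/-- Over a left Artinian ring, each right ideal has the left annihilator of one of its finite
subsets. -/
lemma exists_finset_right_ideal [IsArtinianRing R]
    (N : Submodule Rᵐᵒᵖ R) : ∃ F : Finset R, (∀ y ∈ F, y ∈ N) ∧
      ∀ x ∈ N, ∀ s : R, (∀ y ∈ F, s * y = 0) → s * x = 0 := by
  classical
  obtain ⟨_, ⟨F, hFN, rfl⟩, hmin⟩ := wellFounded_lt.has_min
    {I : Ideal R | ∃ F : Finset R, (∀ y ∈ F, y ∈ N) ∧ lAnn (F : Set R) = I} ⟨_, ∅, by simp, rfl⟩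
  refine ⟨F, hFN, fun x hx s hs => ?_⟩
  have hle : lAnn ((insert x F : Finset R) : Set R) ≤ lAnn (F : Set R) :=
    lAnn_anti (by simp)
  have heq := hle.eq_of_not_lt (hmin _ ⟨insert x F, by
    intro y hy
    obtain rfl | hy := Finset.mem_insert.1 hy
    exacts [hx, hFN y hy], rfl⟩)
  have hs' : s ∈ lAnn (F : Set R) := fun y hy => hs y hy
  rw [← heq] at hs'
  exact hs' x (by simp)

/-- Right ideals are determined by their left annihilators, which form an ascending chain of left
ideals. -/
lemma isArtinian_right [IsArtinianRing R] (hR : Module.Injective R R) : IsArtinian Rᵐᵒᵖ R := by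
  rw [← monotone_stabilizes_iff_artinian]
  intro f
  let N : ℕ → Submodule Rᵐᵒᵖ R := fun n => OrderDual.ofDual (f n)
  have hN : ∀ m n, m ≤ n → N n ≤ N m := fun m n h => f.monotone h
  obtain ⟨n, hn⟩ := monotone_stabilizes_iff_noetherian.2 (inferInstance : IsNoetherian R R)
    ⟨fun n => lAnn (N n : Set R), fun m n h => lAnn_anti (hN m n h)⟩
  refine ⟨n, fun m hm => ?_⟩
  change N n = N m
  refine le_antisymm (fun x hx => ?_) (hN n m hm)
  obtain ⟨F, hFN, hF⟩ := exists_finset_right_ideal (N m)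
  obtain ⟨c, hc⟩ := exists_sum_mul_eq hR (fun y : F => y.1) x fun s hs => by
    have h1 : s ∈ lAnn (N m : Set R) := fun z hz => hF z hz s fun y hy => hs ⟨y, hy⟩
    have h2 : lAnn (N n : Set R) = lAnn (N m : Set R) := hn m hm
    rw [← h2] at h1
    exact h1 x hx
  rw [hc]
  exact sum_mem fun y _ => (N m).smul_mem (op (c y)) (hFN y y.2)

/-- Baer's criterion: let `a` be finitely many generators of the right ideal and `b` their images.
If `b ∉ R a`, a functional kills `a` but not `b`, contradicting that `g` respects relations; so `g`
is left multiplication by some `c`. -/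
lemma injective_right [IsArtinianRing R] (hR : Module.Injective R R)
    (hK : ∀ L : Ideal R, L.IsMaximal → ∃ f : (R ⧸ L) →ₗ[R] R, Function.Injective f) :
    Module.Injective Rᵐᵒᵖ R := by
  classical
  refine Module.Baer.injective fun I g => ?_
  let N : Submodule Rᵐᵒᵖ R :=
    { carrier := {x | op x ∈ I}
      add_mem' := fun hx hy => I.add_mem hx hy
      zero_mem' := I.zero_mem
      smul_mem' := fun c _ hx => I.smul_mem c hx }
  obtain ⟨F, hFN, hF⟩ := exists_finset_right_ideal N
  let a : F → R := fun y => y.1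
  let o : F → I := fun y => ⟨op y.1, hFN y y.2⟩
  let b : F → R := fun y => g (o y)
  have hb : b ∈ Submodule.span R {a} := by
    by_contra hb
    obtain ⟨k, hk⟩ := exists_map_ne_zero hR hK ((Submodule.span R {a}).mkQ b)
      fun h => hb ((Submodule.Quotient.mk_eq_zero _).1 h)
    let k' : (F → R) →ₗ[R] R := k ∘ₗ (Submodule.span R {a}).mkQ
    let r : F → R := fun y => k' fun j => if y = j then 1 else 0
    have hka : ∑ y, a y * r y = 0 := by
      have h1 : k' a = 0 := by
        change k (Submodule.Quotient.mk a) = 0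
        rw [(Submodule.Quotient.mk_eq_zero _).2 (Submodule.mem_span_singleton_self a), map_zero]
      rw [← h1, LinearMap.pi_apply_eq_sum_univ k' a]
      rfl
    have hkb : k' b = ∑ y, b y * r y := LinearMap.pi_apply_eq_sum_univ k' b
    have h0 : ∑ y, op (r y) • o y = 0 := by
      apply Subtype.ext
      rw [Submodule.coe_sum, Submodule.coe_zero, ← op_zero, ← hka, Finset.op_sum]
      rfl
    apply hk
    change k' b = 0
    rw [hkb, ← map_zero g, ← h0, map_sum]
    exact Finset.sum_congr rfl fun y _ => (map_smul g (op (r y)) (o y)).symm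
  obtain ⟨c, hc⟩ := Submodule.mem_span_singleton.1 hb
  have hc' : ∀ y, c * y.1 = g (o y) := fun y => congrFun hc y
  refine ⟨LinearMap.toSpanSingleton Rᵐᵒᵖ R c, fun x hx => ?_⟩
  obtain ⟨d, hd⟩ := exists_sum_mul_eq hR a (unop x) fun s hs =>
    hF (unop x) hx s fun y hy => hs ⟨y, hy⟩
  have hx' : (⟨x, hx⟩ : I) = ∑ y, op (d y) • o y := by
    have h1 : x = op (∑ y, a y * d y) := by rw [← hd, op_unop]
    refine Subtype.ext (h1.trans ?_)
    rw [Submodule.coe_sum, Finset.op_sum]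
    rfl
  rw [hx', map_sum]
  change c * unop x = _
  rw [hd, Finset.mul_sum]
  refine Finset.sum_congr rfl fun y _ => ?_
  rw [map_smul, ← hc', ← mul_assoc]
  rfl

/-- If all free left modules are injective, the ring is quasi-Frobenius. -/
lemma isQuasiFrobenius_of_free_injective (hI : ∀ ι : Type u, Module.Injective R (ι →₀ R)) :
    IsQuasiFrobenius R := by
  have hK : ∀ L : Ideal R, L.IsMaximal → ∃ f : (R ⧸ L) →ₗ[R] R, Function.Injective f := by
    intro L hL
    have : IsSimpleModule R (R ⧸ L) := isSimpleModule_iff_isCoatom.2 (Ideal.isMaximal_def.1 hL)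
    exact exists_simple_embedding hI (R ⧸ L)
  have hR := injective_self_of_finsupp hI
  have := isSemiprimaryRing_of_free_injective hI
  have : IsNoetherian R R := isNoetherianRing_of_free_injective hI hK
  have hA : IsArtinianRing R := IsSemiprimaryRing.isNoetherian_iff_isArtinian.1 this
  exact ⟨hA, isArtinian_right hR, hR, injective_right hR hK⟩

/-! ### Over a quasi-Frobenius ring, injectives are projective. -/

/-- Over a left Noetherian right self-injective ring every simple left module embeds in the
ring. -/
lemma exists_simple_embedding_of_injective_right [IsNoetherianRing R]
    (hR : Module.Injective Rᵐᵒᵖ R) (T : Type u) [AddCommGroup T] [Module R T]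
    [hT : IsSimpleModule R T] : ∃ f : T →ₗ[R] R, Function.Injective f := by
  classical
  obtain ⟨L, hL, ⟨e⟩⟩ := isSimpleModule_iff_quot_maximal.1 hT
  have hs : IsSimpleModule R (R ⧸ L) := IsSimpleModule.congr e.symm
  suffices h : ∃ x : R, x ≠ 0 ∧ ∀ y ∈ L, y * x = 0 by
    obtain ⟨x, hx, hLx⟩ := h
    let f : (R ⧸ L) →ₗ[R] R := L.liftQ (LinearMap.toSpanSingleton R R x) fun y hy => hLx y hy
    have hf : f (L.mkQ 1) = x := one_mul x
    have hfinj : Function.Injective f := LinearMap.injective_of_ne_zero fun h0 => hx (by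
      rw [← hf, h0, LinearMap.zero_apply])
    exact ⟨f ∘ₗ e.toLinearMap, hfinj.comp e.injective⟩
  obtain ⟨s, hs⟩ := (isNoetherianRing_iff_ideal_fg R).1 inferInstance L
  by_contra hcon
  push Not at hcon
  -- If no nonzero `x` is killed by `L`, this map from `R` is injective; a right-linear retraction
  -- `h` then writes `1` as `∑ h (e_y) * y ∈ L`.
  let φ : R →ₗ[Rᵐᵒᵖ] (s → R) :=
    { toFun := fun x y => y.1 * x
      map_add' := fun x z => funext fun y => mul_add _ _ _
      map_smul' := fun r x => funext fun y => (mul_assoc y.1 x (unop r)).symm }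
  have hφ : Function.Injective φ := by
    rw [← LinearMap.ker_eq_bot, LinearMap.ker_eq_bot']
    intro x hx
    by_contra hx0
    obtain ⟨y, hy, hyx⟩ := hcon x hx0
    refine hyx (mem_lAnn.1 ?_ x (Set.mem_singleton x))
    refine (hs ▸ Submodule.span_le.2 fun y hy z hz => ?_ : L ≤ lAnn {x}) hy
    rw [Set.mem_singleton_iff.1 hz]
    exact congrFun hx ⟨y, hy⟩
  obtain ⟨h, hh⟩ := hR.out φ hφ LinearMap.id
  refine hL.ne_top ((Ideal.eq_top_iff_one L).2 ?_)
  have h1 : h (φ 1) = 1 := hh 1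
  have h2 : φ 1 = ∑ y : s, op y.1 • (Pi.single y 1 : s → R) := by
    funext j
    rw [Finset.sum_apply, Finset.sum_eq_single j]
    · simp [φ]
    · intro y _ hy
      simp [hy.symm]
    · simp
  rw [← h1, h2, map_sum]
  refine sum_mem fun y _ => ?_
  rw [map_smul]
  exact L.mul_mem_left _ (hs ▸ Submodule.subset_span y.2)

/-- Over a left Artinian ring that is left self-injective and contains all simple modules, every
injective module is projective. -/
lemma projective_of_injective [IsArtinianRing R] (hR : Module.Injective R R)
    (hK : ∀ (T : Type u) [AddCommGroup T] [Module R T] [IsSimpleModule R T],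
      ∃ f : T →ₗ[R] R, Function.Injective f)
    (M : Type u) [AddCommGroup M] [Module R M] (hM : Module.Injective R M) :
    Module.Projective R M := by
  classical
  let Soc : Submodule R M := ⨆ m ∈ {m : Submodule R M | IsSimpleModule R m}, m
  have hSoc : IsSemisimpleModule R Soc :=
    isSemisimpleModule_biSup_of_isSemisimpleModule_submodule (p := fun m : Submodule R M => m)
      fun m (hm : IsSimpleModule R m) => inferInstance
  obtain ⟨s, e, -, hs⟩ := IsSemisimpleModule.exists_linearEquiv_dfinsupp R Soc
  choose f hf using fun m : s => hK m.1
  let F : Soc →ₗ[R] Π₀ _ : s, R := DFinsupp.mapRange.linearMap f ∘ₗ e.toLinearMap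
  have hF : Function.Injective F :=
    (DFinsupp.mapRange_injective (fun i => f i) (fun i => map_zero (f i))).2 hf |>.comp e.injective
  obtain ⟨g, hg⟩ := (injective_dfinsupp (fun _ : s => R) fun _ => hR).out Soc.subtype
    Subtype.val_injective F
  -- A nonzero kernel would contain a simple module, which lies in the socle, where `g` is
  -- injective.
  have hginj : Function.Injective g := by
    rw [← LinearMap.ker_eq_bot]
    by_contra hne
    obtain ⟨S, hS⟩ := exists_simple_submodule_of_semiprimary (R := R) (LinearMap.ker g)
      (Submodule.nontrivial_iff_ne_bot.2 hne)
    let S' := S.map (LinearMap.ker g).subtype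
    have hS' : IsSimpleModule R S' :=
      IsSimpleModule.congr (S.equivMapOfInjective _ Subtype.val_injective).symm
    have := IsSimpleModule.nontrivial R S'
    obtain ⟨x, hx⟩ := exists_ne (0 : S')
    have hxSoc : x.1 ∈ Soc := le_biSup (fun m : Submodule R M => m) hS' x.2
    obtain ⟨y, -, hy⟩ := x.2
    have hgx : g x.1 = 0 := hy ▸ y.2
    have h1 := hg ⟨x.1, hxSoc⟩
    have h2 : (⟨x.1, hxSoc⟩ : Soc) = 0 := hF (by rw [map_zero, ← h1]; exact hgx)
    have h3 : x.1 = 0 := congrArg Subtype.val h2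
    exact hx (Subtype.ext h3)
  obtain ⟨r, hr⟩ := hM.out g hginj LinearMap.id
  exact Module.Projective.of_split g r (LinearMap.ext hr)

end ESemimod

theorem theorem5p4 (S : Type u) [Semiring S] :
    List.TFAE [
      ESemimod.IsQuasiFrobeniusRing S,
      ∀ (P : Type u) [AddCommMonoid P] [Module S P],
        Module.Projective S P → ESemimod.EInjective S P,
      (∀ (M : Type u) [AddCommMonoid M] [Module S M],
        ESemimod.EInjective S M → Module.Projective S M) ∧
      ∃ (M : Type u) (_ : AddCommMonoid M) (_ : Module S M),
        ESemimod.EInjective S M ∧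
          ∃ φ : (ESemimod.bourneCon (ESemimod.V S S)).Quotient →ₗ[S] M, Function.Injective φ] := by
  tfae_have 1 → 2 := by
    rintro ⟨R, rfl, hA, -, hR, -⟩ P _ _ hP
    let _ : AddCommGroup P := Module.addCommMonoidToAddCommGroup S
    have : IsArtinianRing S := hA
    exact ESemimod.eInjective_iff_injective.2 (ESemimod.injective_of_projective
      (ESemimod.injective_finsupp_of_noetherian hR) P hP)
  tfae_have 1 → 3 := by
    rintro ⟨R, rfl, hA, -, hR, hR'⟩
    have : IsArtinianRing S := hA
    refine ⟨fun M _ _ hM => ?_, PUnit, inferInstance, inferInstance, ESemimod.eInjective_punit,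
      0, fun x y _ => ?_⟩
    · let _ : AddCommGroup M := Module.addCommMonoidToAddCommGroup S
      exact ESemimod.projective_of_injective hR
        (fun T _ _ _ => ESemimod.exists_simple_embedding_of_injective_right hR' T) M
        (ESemimod.eInjective_iff_injective.1 hM)
    -- Over a ring `V(S) = S`, so `S/V(S)` is a single point.
    · obtain ⟨x, rfl⟩ := ESemimod.conMk_surjective _ x
      obtain ⟨y, rfl⟩ := ESemimod.conMk_surjective _ y
      exact ESemimod.conMk_eq_iff.2
        (ESemimod.bourne_of_mem_V ⟨-x, add_neg_cancel x⟩ ⟨-y, add_neg_cancel y⟩)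
  tfae_have 2 → 1 := by
    intro h
    obtain ⟨R, rfl⟩ := ESemimod.exists_ring_of_one_mem_V S
      (ESemimod.one_mem_V_of_eInjective_finsupp (h _ inferInstance))
    exact ⟨R, rfl, ESemimod.isQuasiFrobenius_of_free_injective fun ι =>
      ESemimod.eInjective_iff_injective.1 (h _ inferInstance)⟩
  tfae_have 3 → 1 := by
    rintro ⟨h, M, _, _, hM, φ, hφ⟩
    obtain ⟨R, rfl⟩ := ESemimod.exists_ring_of_one_mem_V S
      (ESemimod.one_mem_V_of_eInjective_projective h hM φ hφ)
    exact ⟨R, rfl, ESemimod.isQuasiFrobenius_of_free_injective fun ι =>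
      ESemimod.projective_injective_of_injective_projective
        (fun M _ _ hM => h M (ESemimod.eInjective_iff_injective.2 hM)) _ inferInstance⟩
  tfae_finish
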